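/- **Setting.** Let $\partial=\partial_\infty\mathbf H^2$ be the oriented circle at infinity of the hyperbolic plane. An (oriented) geodesic $g$ is an ordered pair $(g^-,g^+)$ of distinct points of $\partial$, and $\bar g=(g^+,g^-)$. A pair of equal points is called a phantom geodesic. Let $o(a,b,c)\in\{1,-1,0\}$ be $1$ if $(a,b,c)$ is positively oriented, $-1$ if it is negatively oriented, $0$ if the points are not distinct. The intersection number of two (possibly phantom) pairs is $\epsilon(g,h)=\frac12\big(o(g^+,h^+,g^-)-o(g^+,h^-,g^-)\big)\in\{0,\pm\frac12,\pm1\}$. A configuration $G=\lceil g_1,\dots,g_p\rceil$, $p\ge1$, is a $p$-tuple of geodesics up to cyclic permutation. Its ghost polygon has the $p$ visible edges $\theta=g_i$, with sign $s_\theta=1$ and opposite tuple $\theta^*=(g_i,g_{i+1},\dots,g_{i-1},g_i)$ (of length $p+1$), and the $p$ ghost edges $\theta=(g_{i+1}^-,g_i^+)$, possibly phantom, with sign $s_\theta=-1$ and $\theta^*=(g_{i+1},\dots,g_{i-1},g_i)$ (of length $p$). The algebra $\mathcal A_P$ is the real polynomial algebra freely generated by a Casimir element $\boldsymbol 1$ (different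 from the unit), the geodesics, and the configurations. The ghost bracket on $\mathcal A_P$ is the biderivation with $[\boldsymbol 1,\cdot]=0$ and, for geodesics $g,h$ and configurations $G,H$ (sums over the edges $\theta$ of $G$ and $\sigma$ of $H$), $$[g,h]=\epsilon(h,g)\big(\lceil h,g\rceil-\boldsymbol 1\big),\quad [G,h]=-[h,G]=-\sum_{\theta}s_\theta\,\epsilon(h,\theta)\lceil h,\theta^*\rceil,\quad [G,H]=\sum_{\theta,\sigma}s_\theta s_\sigma\,\epsilon(\sigma,\theta)\lceil\theta^*,\sigma^*\rceil .$$ Orientation reversal is the algebra morphism with $\overline{\boldsymbol 1}=\boldsymbol 1$, $g\mapsto\bar g$, $\overline{\lceil g_1,\dots,g_p\rceil}=\lceil\bar g_p,\dots,\bar g_1\rceil$. The swapping algebra $\mathcal L$ is the algebra of real polynomials in the pairs $(X,x)$ of points of $\partial$, with $(x,x)=0$, and with the biderivation $[(X,x),(Y,y)]=\epsilon((Y,y),(X,x))\,(X,y)(Y,x)$. A geodesic $g$ is identified with the pair $(X,x)=(g^+,g^-)$. A multifraction is an element $[X,x;\sigma]=\prod_{i}(X_i,x_{\sigma(i)})/\prod_i(X_i,x_i)$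 of the fraction field of $\mathcal L$, where $X,x\in\partial^n$, $X_i\ne x_i$, $\sigma\in\mathfrak S(n)$. The linear span $\mathcal B$ of the multifractions is an algebra. The extended swapping algebra is the polynomial algebra $\mathcal B_0=\mathcal B[\ell_g\ (g\text{ a geodesic}),\boldsymbol 1]$, with the swapping bracket (extended to fractions) further extended as a biderivation by: $\boldsymbol 1$ is central, $[\ell_g,\ell_h]=\frac{[g,h]}{gh}+\epsilon(g,h)\boldsymbol 1$, and $[G,\ell_h]=\frac1h[G,h]=-[\ell_h,G]$ for $G\in\mathcal B$. Orientation reversal on $\mathcal B_0$ is the algebra morphism induced by $(X,x)\mapsto(x,X)$, $\ell_g\mapsto\ell_{\bar g}$, $\boldsymbol 1\mapsto\boldsymbol 1$. Let $\Gamma$ be the fundamental group of a closed oriented hyperbolic surface, seen as a torsion-free discrete cocompact subgroup of $\mathsf{PSL}_2(\mathbb R)$, and $\rho$ a projective Anosov representation of $\Gamma$ on a finite-dimensional real vector space $V$, with limit maps $\xi:\partial\to\mathbb P(V)$, $\xi^*:\partial\to\mathbb P(V^*)$. That is, $\xi$ and $\xi^*$ are continuous, $\rho$-equivariant, satisfy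 $\xi(a)\subset\ker\xi^*(a)$ for all $a$ and $\xi(b)\not\subset\ker\xi^*(a)$ for $a\ne b$; and, for some continuous $\Gamma$-invariant Euclidean metric on the flat bundle with fibre $V$ over the unit tangent bundle of $\mathbf H^2$, the lift of the geodesic flow by parallel transport contracts the line $\xi(g^+)$ uniformly exponentially relatively to the hyperplane $\ker\xi^*(g^-)$ along every geodesic $g$. Let $\mathrm p(g)$ be the projector on $\xi(g^+)$ parallel to $\ker\xi^*(g^-)$. Then $A\mapsto\mathsf T_A(\rho)$ is the algebra morphism $\mathcal A_P\to\mathbb R$ with $\mathsf T_{\boldsymbol 1}(\rho)=1/\dim V$, $\mathsf T_g(\rho)=\operatorname{Tr}\mathrm p(g)$ and $\mathsf T_{\lceil g_1,\dots,g_p\rceil}(\rho)=\operatorname{Tr}(\mathrm p(g_p)\cdots\mathrm p(g_1))$. **Theorem.** $\mathcal B_0$ is stable under the extended swapping bracket, and there is a homomorphism of commutative algebras $\pi:\mathcal A_P\to\mathcal B_0$ with $$\pi(\boldsymbol 1)=\boldsymbol 1,\qquad \pi(g)=\ell_g,\qquad \pi(\lceil g_1,\dots,g_p\rceil)=\frac{\prod_{i=1}^p(g_i^+,g_{i+1}^-)}{\prod_{i=1}^p(g_i^+,g_i^-)}\quad(\text{indices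 modulo } p),$$ which is surjective and satisfies $[\pi(A),\pi(B)]=\pi([A,B])$ and $\overline{\pi(A)}=\pi(\overline A)$ for all $A,B\in\mathcal A_P$. If $\pi(A)=0$, then $\mathsf T_A(\rho)=0$ for every such $\Gamma$ and every projective Anosov representation $\rho$ of $\Gamma$. Consequently the ghost bracket descends to $\mathcal A_P/\ker\pi$ and makes it a Poisson algebra (antisymmetry, Leibniz rule, Jacobi identity). -/

import Mathlib

open scoped MatrixGroups LinearAlgebra.Projectivization OnePoint

namespace GhostSwap

noncomputable section

/-! ### Points at infinity, geodesics, intersection numbers -/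

/-- The boundary at infinity `ℝ ∪ {∞}` of the upper half-plane model of the hyperbolic plane. -/
abbrev Boundary : Type := OnePoint ℝ

/-- The circle cut open at `∞`: the real numbers in their order, followed by `∞`. -/
def cut (a : Boundary) : WithTop ℝ := a.elim ⊤ (fun r : ℝ => (r : WithTop ℝ))

/-- The triple `(a, b, c)` of points of the oriented circle is (strictly) positively oriented. -/
def Oriented (a b c : Boundary) : Prop :=
  (cut a < cut b ∧ cut b < cut c) ∨ (cut b < cut c ∧ cut c < cut a) ∨
    (cut c < cut a ∧ cut a < cut b)

open Classical in
/-- `1` on positively oriented triples, `-1` on negatively oriented triples, and `0` on triples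
that are not pairwise distinct. -/
def orientation (a b c : Boundary) : ℝ :=
  if Oriented a b c then 1 else if Oriented c b a then -1 else 0

/-- The intersection number `ε(g, h)` of two pairs of points of the boundary, a pair being
`(start, end) = (g⁻, g⁺)` and phantom if its two points coincide.  The lemmas below check that this
formula satisfies the rules that characterize the intersection number. -/
def intersection (g h : Boundary × Boundary) : ℝ :=
  (orientation g.2 h.2 g.1 - orientation g.2 h.1 g.1) / 2

theorem cut_injective : Function.Injective cut := by
  intro a b h
  induction a using OnePoint.rec <;> induction b using OnePoint.rec <;> simp_all [cut]

open Classical in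
/-- The sign of `b - a` for the order of the circle cut open at `∞`. -/
def cutSign (a b : Boundary) : ℝ :=
  if cut a < cut b then 1 else if cut b < cut a then -1 else 0

theorem cutSign_swap (a b : Boundary) : cutSign b a = -cutSign a b := by
  unfold cutSign
  split_ifs <;> grind

theorem orientation_eq (a b c : Boundary) :
    orientation a b c = cutSign a b + cutSign b c + cutSign c a := by
  unfold orientation Oriented cutSign
  rcases lt_trichotomy (cut a) (cut b) with h1 | h1 | h1 <;>
  rcases lt_trichotomy (cut b) (cut c) with h2 | h2 | h2 <;>
  rcases lt_trichotomy (cut c) (cut a) with h3 | h3 | h3 <;>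
  grind

theorem intersection_eq (a b c d : Boundary) :
    intersection (a, b) (c, d) =
      (cutSign b d + cutSign d a - cutSign b c - cutSign c a) / 2 := by
  simp only [intersection, orientation_eq]
  ring

theorem intersection_antisymm (g h : Boundary × Boundary) :
    intersection g h = -intersection h g := by
  obtain ⟨a, b⟩ := g
  obtain ⟨c, d⟩ := h
  rw [intersection_eq, intersection_eq]
  linarith [cutSign_swap b d, cutSign_swap d a, cutSign_swap b c, cutSign_swap c a]

theorem intersection_reverse_left (a b : Boundary) (h : Boundary × Boundary) :
    intersection (b, a) h = -intersection (a, b) h := by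
  obtain ⟨c, d⟩ := h
  rw [intersection_eq, intersection_eq]
  linarith [cutSign_swap b d, cutSign_swap d a, cutSign_swap b c, cutSign_swap c a]

theorem intersection_self (g : Boundary × Boundary) : intersection g g = 0 := by
  linarith [intersection_antisymm g g]

theorem intersection_phantom (a : Boundary) (h : Boundary × Boundary) :
    intersection (a, a) h = 0 := by
  linarith [intersection_reverse_left a a h]

/-- Two geodesics that do not meet, even at infinity, have intersection number `0`. -/
theorem intersection_disjoint (a b c d : Boundary)
    (h : (Oriented b c a ∧ Oriented b d a) ∨ (Oriented a c b ∧ Oriented a d b)) :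
    intersection (a, b) (c, d) = 0 := by
  unfold intersection orientation
  rcases h with ⟨h1, h2⟩ | ⟨h1, h2⟩ <;> unfold Oriented at * <;> grind

/-- Two geodesics that cross have intersection number `1` if `(g⁺, h⁺, g⁻, h⁻)` is positively
oriented. -/
theorem intersection_crossing (a b c d : Boundary) (h1 : Oriented b d a) (h2 : Oriented a c b) :
    intersection (a, b) (c, d) = 1 := by
  unfold intersection orientation
  unfold Oriented at *
  grind

/-- Two geodesics with a common starting point have intersection number `1 / 2` if `(g⁺, h⁺, h⁻)`
is positively oriented. -/
theorem intersection_half (a b d : Boundary) (h : Oriented b d a) :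
    intersection (a, b) (a, d) = 1 / 2 := by
  unfold intersection orientation
  unfold Oriented at *
  grind

/-- An oriented geodesic of the hyperbolic plane: an ordered pair of distinct points at infinity,
`src = g⁻` and `tgt = g⁺`. -/
@[ext]
structure Geodesic where
  src : Boundary
  tgt : Boundary
  ne : src ≠ tgt

/-- The pair `(g⁻, g⁺)` of endpoints. -/
def Geodesic.ends (g : Geodesic) : Boundary × Boundary := (g.src, g.tgt)

/-- The same geodesic with the opposite orientation. -/
def Geodesic.rev (g : Geodesic) : Geodesic := ⟨g.tgt, g.src, g.ne.symm⟩

/-- Orientation reversal as a bijection of the set of geodesics. -/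
def Geodesic.revEquiv : Geodesic ≃ Geodesic := ⟨Geodesic.rev, Geodesic.rev, fun _ => rfl, fun _ => rfl⟩

/-! ### Configurations and ghost polygons -/

/-- A configuration `⌈g₁, …, g_p⌉` (`p ≥ 1`): a tuple of geodesics up to cyclic rotation.  It is the
same as a ghost polygon, by `Configuration.edges`. -/
def Configuration : Type := {c : Cycle Geodesic // c ≠ Cycle.nil}

/-- The configuration of a nonempty tuple. -/
def config (l : List Geodesic) (h : l ≠ []) : Configuration :=
  ⟨(l : Cycle Geodesic), by simpa using h⟩

/-- Orientation reversal `⌈g₁, …, g_p⌉ ↦ ⌈ḡ_p, …, ḡ₁⌉`. -/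
def Configuration.rev (G : Configuration) : Configuration :=
  ⟨(G.1.map Geodesic.rev).reverse, fun h => G.2 (by
    have h' := congrArg Cycle.reverse h
    rw [Cycle.reverse_reverse, Cycle.reverse_nil, Cycle.map_eq_nil] at h'
    exact h')⟩

/-- An edge `θ` of a ghost polygon: its endpoints `θ⁻, θ⁺` (which may coincide for a ghost edge), its
sign (`1` for visible, `-1` for ghost edges), and its opposite ordered configuration `θ*`. -/
structure PolygonEdge where
  ends : Boundary × Boundary
  sign : ℝ
  opp : List Geodesic
  opp_ne : opp ≠ []

/-- The two edges attached to the ordered representative `(g₁, …, g_p)` of a configuration: the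
visible edge `g₁`, with opposite `(g₁, g₂, …, g_p, g₁)`, and the ghost edge `(g₁⁻, g_p⁺)` between
`g_p` and `g₁`, with opposite `(g₁, g₂, …, g_p)`. -/
def edgesAt : List Geodesic → Multiset PolygonEdge
  | [] => 0
  | g :: l =>
    {⟨g.ends, 1, g :: l ++ [g], by simp⟩,
     ⟨(g.src, ((g :: l).getLast (by simp)).tgt), -1, g :: l, by simp⟩}

/-- The `2p` edges of the ghost polygon of a configuration of rank `p`, with multiplicity: each of
the `p` rotations contributes its first visible edge and the ghost edge before it. -/
def Configuration.edges (G : Configuration) : Multiset PolygonEdge := G.1.lists.bind edgesAt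

/-! ### The projective ghost polynomial algebra -/

/-- The generators of the ghost algebra. -/
inductive GhostGen where
  | casimir : GhostGen
  | geodesic (g : Geodesic) : GhostGen
  | polygon (G : Configuration) : GhostGen

/-- The free polynomial algebra on the Casimir element, the geodesics and the ghost polygons. -/
abbrev GhostAlgebra : Type := MvPolynomial GhostGen ℝ

/-- The Casimir element, a generator different from the unit of the algebra. -/
def casimir : GhostAlgebra := MvPolynomial.X .casimir

/-- A geodesic, as a generator. -/
def geod (g : Geodesic) : GhostAlgebra := MvPolynomial.X (.geodesic g)

/-- The configuration of a nonempty tuple, as a generator. -/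
def poly (l : List Geodesic) (h : l ≠ []) : GhostAlgebra := MvPolynomial.X (.polygon (config l h))

/-- The projective ghost bracket on generators. -/
def genBracket : GhostGen → GhostGen → GhostAlgebra
  | .casimir, _ => 0
  | _, .casimir => 0
  | .geodesic g, .geodesic h =>
    intersection h.ends g.ends • (poly [h, g] (by simp) - casimir)
  | .polygon G, .geodesic h =>
    (G.edges.map fun θ =>
      (-θ.sign * intersection h.ends θ.ends) • poly (h :: θ.opp) (by simp)).sum
  | .geodesic h, .polygon G =>
    -(G.edges.map fun θ =>
      (-θ.sign * intersection h.ends θ.ends) • poly (h :: θ.opp) (by simp)).sum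
  | .polygon G, .polygon H =>
    (G.edges.map fun θ => (H.edges.map fun σ =>
      (θ.sign * σ.sign * intersection σ.ends θ.ends) •
        poly (θ.opp ++ σ.opp) (by simp [θ.opp_ne])).sum).sum

/-- The ghost bracket, extended to polynomials by the Leibniz rule in both arguments. -/
def ghostBracket (A B : GhostAlgebra) : GhostAlgebra :=
  MvPolynomial.mkDerivation ℝ
    (fun s => MvPolynomial.mkDerivation ℝ (fun t => genBracket s t) B) A

/-- Orientation reversal on generators. -/
def GhostGen.rev : GhostGen → GhostGen
  | .casimir => .casimir
  | .geodesic g => .geodesic g.rev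
  | .polygon G => .polygon G.rev

/-- Orientation reversal on the ghost algebra. -/
def ghostReverse : GhostAlgebra →ₐ[ℝ] GhostAlgebra := MvPolynomial.rename GhostGen.rev

/-! ### The swapping algebra and its extension -/

/-- The swapping algebra: real polynomials in the pairs `(X, x)` of points of the circle, with
`(x, x) = 0`; so it is free on the pairs of distinct points.  The pair `(X, x)` is the geodesic with
`g⁺ = X` and `g⁻ = x`. -/
abbrev SwapAlgebra : Type := MvPolynomial Geodesic ℝ

open Classical in
/-- The element `(X, x)` of the swapping algebra. -/
def pair (X x : Boundary) : SwapAlgebra :=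
  if h : x ≠ X then MvPolynomial.X ⟨x, X, h⟩ else 0

/-- The fraction algebra of the swapping algebra. -/
abbrev SwapFraction : Type := FractionRing SwapAlgebra

/-- The element `(X, x)` of the fraction algebra. -/
def fpair (X x : Boundary) : SwapFraction := algebraMap SwapAlgebra SwapFraction (pair X x)

/-- The multifraction `[X, x; σ] = ∏ (X_i, x_{σ i}) / ∏ (X_i, x_i)`, with `g_i = (X_i, x_i)`. -/
def multifraction {n : ℕ} (g : Fin n → Geodesic) (σ : Equiv.Perm (Fin n)) : SwapFraction :=
  (∏ i, fpair (g i).tgt (g (σ i)).src) / ∏ i, fpair (g i).tgt (g i).src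

/-- Polynomials over the fraction algebra in the formal logarithms `ℓ_g` (the variable `some g`) and
the Casimir element (the variable `none`). -/
abbrev LogExtension : Type := MvPolynomial (Option Geodesic) SwapFraction

/-- The formal logarithm `ℓ_g`. -/
def logGeod (g : Geodesic) : LogExtension := MvPolynomial.X (some g)

/-- The central element. -/
def central : LogExtension := MvPolynomial.X none

/-- The element `(X, x)` of the log extension. -/
def lpair (X x : Boundary) : LogExtension := MvPolynomial.C (fpair X x)

/-- The inverse of the geodesic `g`, seen in the fraction algebra. -/
def linv (g : Geodesic) : LogExtension := MvPolynomial.C (fpair g.tgt g.src)⁻¹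

/-- A multifraction, seen in the log extension. -/
def lmulti {n : ℕ} (g : Fin n → Geodesic) (σ : Equiv.Perm (Fin n)) : LogExtension :=
  MvPolynomial.C (multifraction g σ)

/-- The extended swapping algebra `B₀`: generated by the multifractions, the `ℓ_g` and the central
element.  Products of multifractions are multifractions, so this is the algebra of polynomials in the
`ℓ_g` and the central element with coefficients in the linear span of the multifractions. -/
def extendedSwapping : Subalgebra ℝ LogExtension :=
  Algebra.adjoin ℝ
    ({f | ∃ (n : ℕ) (g : Fin n → Geodesic) (σ : Equiv.Perm (Fin n)), f = lmulti g σ} ∪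
      Set.range logGeod ∪ {central})

section Derivation

variable (u : Geodesic → LogExtension) (v : Option Geodesic → LogExtension)

/-- The first-order deformation `(X, x) ↦ (X, x) + ε u` of the inclusion of the swapping algebra. -/
def deform₀ : SwapAlgebra →ₐ[ℝ] TrivSqZeroExt LogExtension LogExtension :=
  MvPolynomial.aeval fun g => TrivSqZeroExt.inl (lpair g.tgt g.src) + TrivSqZeroExt.inr (u g)

theorem fst_deform₀ (p : SwapAlgebra) :
    (deform₀ u p).fst = MvPolynomial.C (algebraMap SwapAlgebra SwapFraction p) := by
  have h : (TrivSqZeroExt.fstHom ℝ LogExtension LogExtension).comp (deform₀ u) =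
      (IsScalarTower.toAlgHom ℝ SwapFraction LogExtension).comp
        (IsScalarTower.toAlgHom ℝ SwapAlgebra SwapFraction) := by
    apply MvPolynomial.algHom_ext
    intro g
    simp [deform₀, lpair, fpair, pair, g.ne]
  exact DFunLike.congr_fun h p

/-- Its extension to the fraction algebra. -/
def deform₁ : SwapFraction →ₐ[ℝ] TrivSqZeroExt LogExtension LogExtension :=
  IsLocalization.liftAlgHom (M := nonZeroDivisors SwapAlgebra) (f := deform₀ u) (by
    intro y
    rw [TrivSqZeroExt.isUnit_iff_isUnit_fst, fst_deform₀]
    exact (IsLocalization.map_units SwapFraction y).map MvPolynomial.C)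

/-- Its extension to the log extension, with `ℓ_g ↦ ℓ_g + ε v` and similarly for the central
element. -/
def deform : LogExtension →ₐ[ℝ] TrivSqZeroExt LogExtension LogExtension :=
  MvPolynomial.aevalTower (deform₁ u) fun o =>
    TrivSqZeroExt.inl (MvPolynomial.X o) + TrivSqZeroExt.inr (v o)

theorem fst_deform (p : LogExtension) : (deform u v p).fst = p := by
  have h : (TrivSqZeroExt.fstHom ℝ LogExtension LogExtension).comp (deform u v) =
      AlgHom.id ℝ LogExtension := by
    apply MvPolynomial.algHom_ext'
    · apply IsLocalization.algHom_ext (nonZeroDivisors SwapAlgebra)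
      refine MvPolynomial.algHom_ext fun p => ?_
      have h2 : Algebra.algHom ℝ SwapAlgebra SwapFraction (MvPolynomial.X p) =
          algebraMap SwapAlgebra SwapFraction (MvPolynomial.X p) := rfl
      have h1 : deform₁ u (algebraMap SwapAlgebra SwapFraction (MvPolynomial.X p)) =
          deform₀ u (MvPolynomial.X p) := IsLocalization.lift_eq _ _
      simp [deform, h2, h1, fst_deform₀]
    · intro o
      simp [deform]
  exact DFunLike.congr_fun h p

/-- The derivation of the log extension over `ℝ` with prescribed values `u` on the pairs of points
and `v` on the variables `ℓ_g` and the central element. -/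
def extDerivation : Derivation ℝ LogExtension LogExtension :=
  Derivation.mk' ((TrivSqZeroExt.sndHom LogExtension LogExtension).restrictScalars ℝ ∘ₗ
    (deform u v).toLinearMap) (by
      intro a b
      simp [fst_deform, mul_comm])

theorem extDerivation_pair (g : Geodesic) : extDerivation u v (lpair g.tgt g.src) = u g := by
  have h1 : deform₁ u (algebraMap SwapAlgebra SwapFraction (MvPolynomial.X g)) =
      deform₀ u (MvPolynomial.X g) := IsLocalization.lift_eq _ _
  have h2 : pair g.tgt g.src = MvPolynomial.X g := by simp [pair, g.ne]
  have h3 : lpair g.tgt g.src =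
      MvPolynomial.C (algebraMap SwapAlgebra SwapFraction (MvPolynomial.X g)) := by
    rw [lpair, fpair, h2]
  rw [h3]
  simp [extDerivation, deform, h1, deform₀, lpair]

theorem extDerivation_X (o : Option Geodesic) :
    extDerivation u v (MvPolynomial.X o) = v o := by
  simp [extDerivation, deform]

end Derivation

/-- The swapping bracket `[(X, x), (Y, y)] = ε((Y, y), (X, x)) (X, y) (Y, x)`, for
`g = (X, x)` and `h = (Y, y)`. -/
def swapBracket (g h : Geodesic) : LogExtension :=
  intersection h.ends g.ends • (lpair g.tgt h.src * lpair h.tgt g.src)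

/-- Bracket with the pair `g`: `[g, h]` is the swapping bracket, and `[g, ℓ_h] = [g, h] / h`. -/
def hamPair (g : Geodesic) : Derivation ℝ LogExtension LogExtension :=
  extDerivation (fun h => swapBracket g h) fun
    | none => 0
    | some h => linv h * swapBracket g h

/-- Bracket with `ℓ_g`: `[ℓ_g, h] = [g, h] / g`, and `[ℓ_g, ℓ_h] = [g, h] / (g h) + ε(g, h) 𝟏`. -/
def hamLog (g : Geodesic) : Derivation ℝ LogExtension LogExtension :=
  extDerivation (fun h => linv g * swapBracket g h) fun
    | none => 0
    | some h => linv g * linv h * swapBracket g h + intersection g.ends h.ends • central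

/-- The extended swapping bracket: the biderivation with the above values on the pairs of points and
the `ℓ_g`, for which the central element is central. -/
def extBracket (a b : LogExtension) : LogExtension :=
  extDerivation (fun g => hamPair g b)
    (fun
      | none => 0
      | some g => hamLog g b) a

/-- Orientation reversal of the fraction algebra, `(X, x) ↦ (x, X)`. -/
def fractionReverse : SwapFraction →ₐ[ℝ] SwapFraction :=
  IsLocalization.liftAlgHom (M := nonZeroDivisors SwapAlgebra)
    (f := (IsScalarTower.toAlgHom ℝ SwapAlgebra SwapFraction).comp
      (MvPolynomial.rename Geodesic.rev)) (by
    intro y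
    refine IsLocalization.map_units SwapFraction (⟨MvPolynomial.rename Geodesic.rev y, ?_⟩ :
      nonZeroDivisors SwapAlgebra)
    rw [mem_nonZeroDivisors_iff_ne_zero]
    exact (map_ne_zero_iff _ (MvPolynomial.rename_injective _ Geodesic.revEquiv.injective)).2
      (nonZeroDivisors.ne_zero y.2))

/-- Orientation reversal of the log extension: `(X, x) ↦ (x, X)`, `ℓ_g ↦ ℓ_ḡ`, and the central
element is fixed. -/
def extReverse : LogExtension →ₐ[ℝ] LogExtension :=
  MvPolynomial.aevalTower ((IsScalarTower.toAlgHom ℝ SwapFraction LogExtension).comp fractionReverse)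
    fun o => MvPolynomial.X (o.map Geodesic.rev)

/-! ### Projective Anosov representations and correlation functions -/

/-- `Γ` is the fundamental group of a closed oriented hyperbolic surface, as a torsion-free cocompact
discrete group of isometries of the hyperbolic plane. -/
def IsClosedSurfaceGroup (Γ : Subgroup PSL(2, ℝ)) : Prop :=
  DiscreteTopology Γ ∧ CompactSpace (PSL(2, ℝ) ⧸ Γ) ∧
    ∀ γ ∈ Γ, ∀ n : ℕ, 0 < n → γ ^ n = 1 → γ = 1

/-- The action of a matrix on the boundary at infinity by its Möbius transformation. -/
def moebius (M : SL(2, ℝ)) (a : Boundary) : Boundary := (M : GL (Fin 2) ℝ) • a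

/-- The matrix `diag (e^{t/2}, e^{-t/2})`.  A matrix `x` represents the unit tangent vector image
under `x` of the upward unit vector at `i`.  Its geodesic has forward endpoint `x · ∞` and backward
endpoint `x · 0`, and the geodesic flow is `x ↦ x * flow t`. -/
def flow (t : ℝ) : SL(2, ℝ) :=
  ⟨!![Real.exp (t / 2), 0; 0, Real.exp (-(t / 2))], by
    simp [Matrix.det_fin_two_of, ← Real.exp_add]⟩

/-- The quotient topology on a projective space. -/
instance projectiveTopology (W : Type*) [NormedAddCommGroup W] [NormedSpace ℝ W] :
    TopologicalSpace (ℙ ℝ W) :=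
  TopologicalSpace.coinduced (Projectivization.mk' ℝ) inferInstance

section Anosov

variable {V : Type*} [NormedAddCommGroup V] [NormedSpace ℝ V]

/-- `ρ` is a projective Anosov representation of `Γ` with limit map `ξ` and dual limit map `ξ'`, a
point of the projective space of the dual being thought of as a hyperplane.  The norm on `V` is only
used for the topology.  A pair `(M, γ)` with `(M : PSL(2, ℝ)) = γ` is an element `γ` of `Γ` and a
matrix that represents it. -/
structure IsProjectiveAnosov (Γ : Subgroup PSL(2, ℝ)) (ρ : Representation ℝ Γ V)
    (ξ : Boundary → ℙ ℝ V) (ξ' : Boundary → ℙ ℝ (V →L[ℝ] ℝ)) : Prop where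
  continuous_limit : Continuous ξ
  continuous_dual : Continuous ξ'
  equivariant_limit : ∀ (γ : Γ) (M : SL(2, ℝ)), (M : PSL(2, ℝ)) = γ → ∀ (a : Boundary) (v : V),
    v ∈ (ξ a).submodule → ρ γ v ∈ (ξ (moebius M a)).submodule
  equivariant_dual : ∀ (γ : Γ) (M : SL(2, ℝ)), (M : PSL(2, ℝ)) = γ → ∀ (a : Boundary) (v : V),
    (ξ' a).rep v = 0 → (ξ' (moebius M a)).rep (ρ γ v) = 0
  compatible : ∀ a : Boundary, (ξ' a).rep (ξ a).rep = 0
  transverse : ∀ a b : Boundary, a ≠ b → (ξ' a).rep (ξ b).rep ≠ 0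
  /-- For some continuous `Γ`-invariant Euclidean metric `q` on the flat bundle over the unit tangent
  bundle, the flow contracts the line of the forward endpoint exponentially with respect to the
  hyperplane of the backward endpoint. -/
  contracting : ∃ q : SL(2, ℝ) → LinearMap.BilinForm ℝ V,
    (∀ x u v, q x u v = q x v u) ∧ (∀ x u, u ≠ 0 → 0 < q x u u) ∧
    (∀ u v, Continuous fun x => q x u v) ∧
    (∀ (γ : Γ) (M : SL(2, ℝ)), (M : PSL(2, ℝ)) = γ →
      ∀ x u v, q (M * x) (ρ γ u) (ρ γ v) = q x u v) ∧
    ∃ B b : ℝ, 0 < B ∧ 0 < b ∧ ∀ (x : SL(2, ℝ)) (t : ℝ), 0 ≤ t → ∀ u v : V,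
      u ∈ (ξ (moebius x ∞)).submodule → (ξ' (moebius x ((0 : ℝ) : Boundary))).rep v = 0 →
      √(q (x * flow t) u u) * √(q x v v) ≤
        B * Real.exp (-(b * t)) * (√(q (x * flow t) v v) * √(q x u u))

variable (ξ : Boundary → ℙ ℝ V) (ξ' : Boundary → ℙ ℝ (V →L[ℝ] ℝ))

/-- The projector `p(g)` on the line `ξ(g⁺)` parallel to the hyperplane `ξ'(g⁻)`. -/
def projector (g : Geodesic) : Module.End ℝ V :=
  ((ξ' g.src).rep (ξ g.tgt).rep)⁻¹ •
    ((ξ' g.src).rep : V →ₗ[ℝ] ℝ).smulRight (ξ g.tgt).rep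

theorem projector_isProj (g : Geodesic) (h : (ξ' g.src).rep (ξ g.tgt).rep ≠ 0) :
    LinearMap.IsProj (ξ g.tgt).submodule (projector ξ ξ' g) ∧
      LinearMap.ker (projector ξ ξ' g) = LinearMap.ker ((ξ' g.src).rep : V →ₗ[ℝ] ℝ) := by
  refine ⟨⟨fun v => ?_, fun v hv => ?_⟩, ?_⟩
  · rw [Projectivization.submodule_eq]
    simp only [projector, LinearMap.smul_apply, LinearMap.smulRight_apply]
    exact Submodule.smul_mem _ _ (Submodule.smul_mem _ _ (Submodule.mem_span_singleton_self _))
  · rw [Projectivization.submodule_eq, Submodule.mem_span_singleton] at hv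
    obtain ⟨c, rfl⟩ := hv
    simp only [projector, LinearMap.smul_apply, LinearMap.smulRight_apply, smul_smul, map_smul,
      ContinuousLinearMap.coe_coe]
    congr 1
    field_simp
  · ext v
    simp [projector, h, (ξ g.tgt).rep_nonzero]

/-- The trace `Tr (p(g_n) ⋯ p(g_1))`. -/
def listTrace (l : List Geodesic) : ℝ :=
  LinearMap.trace ℝ V ((l.reverse.map (projector ξ ξ')).prod)

theorem listTrace_append (l m : List Geodesic) :
    listTrace ξ ξ' (l ++ m) = listTrace ξ ξ' (m ++ l) := by
  simp only [listTrace, List.reverse_append, List.map_append, List.prod_append]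
  exact LinearMap.trace_mul_comm ℝ _ _

/-- The correlation function of a configuration. -/
def Configuration.trace (G : Configuration) : ℝ :=
  Quotient.lift (listTrace ξ ξ') (by
    rintro l m ⟨n, rfl⟩
    rw [← List.rotate_mod, List.rotate_eq_drop_append_take_mod, listTrace_append]
    simp) G.1

/-- The evaluation `A ↦ T_A(ρ)` on the ghost algebra, for `ρ` with limit maps `ξ` and `ξ'`. -/
def correlation : GhostAlgebra →ₐ[ℝ] ℝ :=
  MvPolynomial.aeval fun
    | .casimir => 1 / (Module.finrank ℝ V : ℝ)
    | .geodesic g => LinearMap.trace ℝ V (projector ξ ξ' g)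
    | .polygon G => G.trace ξ ξ'

end Anosov

/-! ### Poisson algebras -/

/-- A bilinear bracket makes a commutative algebra into a Poisson algebra. -/
structure IsPoissonBracket {A : Type*} [CommRing A] [Algebra ℝ A] (br : A →ₗ[ℝ] A →ₗ[ℝ] A) :
    Prop where
  skew : ∀ a b, br a b = -br b a
  leibniz : ∀ a b c, br a (b * c) = br a b * c + b * br a c
  jacobi : ∀ a b c, br a (br b c) + br b (br c a) + br c (br a b) = 0

end

end GhostSwap

open GhostSwap

namespace GhostSwap

noncomputable section

/-! ### Derivations of the log extension -/

/-! To a tuple one attaches the product of the weights `g⁻¹` of its members and of the factors `(g⁺,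
h⁻)` joining each member `g` to its successor `h`: `path` for the open product, `loop` for the one
closed up cyclically. The image of a configuration is its `loop`, and everything follows from
computing with it.

Bracket. A derivation applied to a loop differentiates one factor at a time: a join is a ghost edge,
an inverse weight is a visible edge, and what remains is, up to sign, the path of the opposite tuple
(`Configuration.derivation_loop`). The ends of an edge are those of its opposite tuple
(`Configuration.ends_of_mem_edges`). So in the bracket of two loops the swapping rule `ε (X, y) (Y,
x)` supplies exactly the two joins that glue `θ*` and `σ*` into a single loop (`loop_append`). This
is the ghost bracket on generators; the Leibniz rule on both sides does the rest
(`extBracket_ghostMap`).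

Image. A permutation is a product of disjoint cycles, and a multifraction splits accordingly into
loops (`prod_mem_range`). Hence the image is `extendedSwapping`, which is stable under the bracket
as the image of a bracket-preserving map.

Jacobi. On pairs, the double brackets involve only two monomials, with opposite coefficients. That
coefficient can be nonzero only when one end of each of the three pairs lies at a common point, and
then the monomials agree or both vanish (`coincidence_smul`). Brackets with logarithms reduce to
this, and the quotient inherits the Poisson laws.

Correlations. Projectors of rank one multiply like joins, so the trace of a product is the loop
evaluated at the pairing of the limit maps, with `ℓ_g` evaluated at `1`. Evaluation makes sense only
where denominators survive, so it is done in a localization that injects into the fraction field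
(`correlation_eq_zero`). -/

theorem lpair_self (X : Boundary) : lpair X X = 0 := by
  simp [lpair, fpair, pair]

theorem fpair_ne_zero (g : Geodesic) : fpair g.tgt g.src ≠ 0 := by
  have h : pair g.tgt g.src = MvPolynomial.X g := by simp [pair, g.ne]
  rw [fpair, h]
  exact (map_ne_zero_iff _ (IsFractionRing.injective SwapAlgebra SwapFraction)).2
    (MvPolynomial.X_ne_zero g)

theorem lpair_mul_linv (g : Geodesic) : lpair g.tgt g.src * linv g = 1 := by
  rw [lpair, linv, ← map_mul, mul_inv_cancel₀ (fpair_ne_zero g), map_one]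

/-- Differentiate `x * x⁻¹ = 1`. This is the hypothesis on inverse weights in
`Configuration.derivation_loop`. -/
theorem derivation_linv (D : Derivation ℝ LogExtension LogExtension) (g : Geodesic) :
    D (linv g) = -(linv g * linv g * D (lpair g.tgt g.src)) := by
  have h := congrArg D (lpair_mul_linv g)
  rw [D.leibniz, D.map_one_eq_zero, smul_eq_mul, smul_eq_mul] at h
  linear_combination linv g * h - D (linv g) * lpair_mul_linv g

theorem lpair_eq_C_X (g : Geodesic) : lpair g.tgt g.src =
    MvPolynomial.C (algebraMap SwapAlgebra SwapFraction (MvPolynomial.X g)) := by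
  have h : pair g.tgt g.src = MvPolynomial.X g := by simp [pair, g.ne]
  rw [lpair, fpair, h]

/-- The quotient rule: applying both derivations to `(P / Q) * Q = P` and cancelling `Q` reduces
fractions to polynomials, where constants are killed and the Leibniz rule reduces to variables. -/
theorem derivation_C_ext {D₁ D₂ : Derivation ℝ LogExtension LogExtension}
    (h : ∀ g : Geodesic, D₁ (lpair g.tgt g.src) = D₂ (lpair g.tgt g.src)) (f : SwapFraction) :
    D₁ (MvPolynomial.C f) = D₂ (MvPolynomial.C f) := by
  have hp : ∀ p : SwapAlgebra, D₁ (MvPolynomial.C (algebraMap SwapAlgebra SwapFraction p)) =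
      D₂ (MvPolynomial.C (algebraMap SwapAlgebra SwapFraction p)) := by
    intro p
    induction p using MvPolynomial.induction_on with
    | C r =>
      have : (MvPolynomial.C (algebraMap SwapAlgebra SwapFraction (MvPolynomial.C r)) :
          LogExtension) = algebraMap ℝ LogExtension r := by
        rw [IsScalarTower.algebraMap_apply ℝ SwapFraction LogExtension,
          IsScalarTower.algebraMap_apply ℝ SwapAlgebra SwapFraction]
        rfl
      rw [this, D₁.map_algebraMap, D₂.map_algebraMap]
    | add p q hp hq => simp only [map_add, hp, hq]
    | mul_X p g hp => simp only [map_mul, Derivation.leibniz, hp, ← lpair_eq_C_X, h]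
  obtain ⟨p, q, hq, rfl⟩ := IsFractionRing.div_surjective (A := SwapAlgebra) f
  set P : SwapFraction := algebraMap SwapAlgebra SwapFraction p
  set Q : SwapFraction := algebraMap SwapAlgebra SwapFraction q with hQ
  have hQ0 : Q ≠ 0 := IsFractionRing.to_map_ne_zero_of_mem_nonZeroDivisors hq
  have hC : (MvPolynomial.C (P / Q) : LogExtension) * MvPolynomial.C Q = MvPolynomial.C P := by
    rw [← map_mul, div_mul_cancel₀ _ hQ0]
  have h1 := congrArg D₁ hC
  have h2 := congrArg D₂ hC
  rw [Derivation.leibniz, smul_eq_mul, smul_eq_mul] at h1 h2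
  have hC0 : (MvPolynomial.C Q : LogExtension) ≠ 0 := by
    rwa [Ne, MvPolynomial.C_eq_zero]
  apply mul_left_cancel₀ hC0
  linear_combination h1 - h2 + hp p - MvPolynomial.C (P / Q) * hp q

theorem derivation_ext {D₁ D₂ : Derivation ℝ LogExtension LogExtension}
    (h : ∀ g : Geodesic, D₁ (lpair g.tgt g.src) = D₂ (lpair g.tgt g.src))
    (h' : ∀ o, D₁ (MvPolynomial.X o) = D₂ (MvPolynomial.X o)) : D₁ = D₂ := by
  refine Derivation.ext fun f => ?_
  induction f using MvPolynomial.induction_on with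
  | C r => exact derivation_C_ext h r
  | add p q hp hq => simp only [map_add, hp, hq]
  | mul_X p g hp => simp only [Derivation.leibniz, hp, h']

theorem derivation_ext' {D₁ D₂ : Derivation ℝ LogExtension LogExtension}
    (h : ∀ g : Geodesic, D₁ (lpair g.tgt g.src) = D₂ (lpair g.tgt g.src))
    (hl : ∀ g, D₁ (logGeod g) = D₂ (logGeod g)) (hc : D₁ central = D₂ central) : D₁ = D₂ :=
  derivation_ext h fun o => by
    cases o
    · exact hc
    · exact hl _

/-! ### The extended swapping bracket as a skew biderivation -/

/-- The bracket with `b` on the right, as a derivation. -/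
def rightBracket (b : LogExtension) : Derivation ℝ LogExtension LogExtension :=
  extDerivation (fun g => hamPair g b)
    (fun
      | none => 0
      | some g => hamLog g b)

theorem rightBracket_apply (a b : LogExtension) : rightBracket b a = extBracket a b := rfl

theorem extBracket_pair (g : Geodesic) (b : LogExtension) :
    extBracket (lpair g.tgt g.src) b = hamPair g b :=
  extDerivation_pair _ _ g

theorem extBracket_logGeod (g : Geodesic) (b : LogExtension) :
    extBracket (logGeod g) b = hamLog g b :=
  extDerivation_X _ _ (some g)

theorem extBracket_central (b : LogExtension) : extBracket central b = 0 :=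
  extDerivation_X _ _ none

theorem swapBracket_swap (g h : Geodesic) : swapBracket h g = -swapBracket g h := by
  rw [swapBracket, swapBracket, intersection_antisymm, neg_smul, mul_comm]

theorem hamPair_pair (g h : Geodesic) : hamPair g (lpair h.tgt h.src) = swapBracket g h :=
  extDerivation_pair _ _ h

theorem hamPair_logGeod (g h : Geodesic) : hamPair g (logGeod h) = linv h * swapBracket g h :=
  extDerivation_X _ _ (some h)

theorem hamPair_central (g : Geodesic) : hamPair g central = 0 :=
  extDerivation_X _ _ none

theorem hamLog_pair (g h : Geodesic) :
    hamLog g (lpair h.tgt h.src) = linv g * swapBracket g h :=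
  extDerivation_pair _ _ h

theorem hamLog_logGeod (g h : Geodesic) : hamLog g (logGeod h) =
    linv g * linv h * swapBracket g h + intersection g.ends h.ends • central :=
  extDerivation_X _ _ (some h)

theorem hamLog_central (g : Geodesic) : hamLog g central = 0 :=
  extDerivation_X _ _ none

/-- By construction the bracket is a derivation only in its left argument. Each law in the right
argument is an equality of derivations of the left one, so it need only hold on left generators,
where the bracket is a derivation `hamPair g` or `hamLog g` or is zero. -/
theorem extBracket_add_right (a b c : LogExtension) :
    extBracket a (b + c) = extBracket a b + extBracket a c := by
  have : rightBracket (b + c) = rightBracket b + rightBracket c := by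
    apply derivation_ext'
    · intro g
      simp only [Derivation.add_apply, rightBracket_apply, extBracket_pair, map_add]
    · intro g
      simp only [Derivation.add_apply, rightBracket_apply, extBracket_logGeod, map_add]
    · simp only [Derivation.add_apply, rightBracket_apply, extBracket_central, add_zero]
  exact DFunLike.congr_fun this a

theorem extBracket_smul_right (r : ℝ) (a b : LogExtension) :
    extBracket a (r • b) = r • extBracket a b := by
  have : rightBracket (r • b) = r • rightBracket b := by
    apply derivation_ext'
    · intro g
      simp only [Derivation.smul_apply, rightBracket_apply, extBracket_pair, Derivation.map_smul]
    · intro g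
      simp only [Derivation.smul_apply, rightBracket_apply, extBracket_logGeod,
        Derivation.map_smul]
    · simp only [Derivation.smul_apply, rightBracket_apply, extBracket_central, smul_zero]
  exact DFunLike.congr_fun this a

/-- The derivation `a • D`. -/
def scaledDerivation {A : Type*} [CommRing A] [Algebra ℝ A] (a : A) (D : Derivation ℝ A A) :
    Derivation ℝ A A := a • D

theorem scaledDerivation_apply {A : Type*} [CommRing A] [Algebra ℝ A] (a : A)
    (D : Derivation ℝ A A) (b : A) : scaledDerivation a D b = a * D b := rfl

theorem extBracket_mul_right (a b c : LogExtension) :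
    extBracket a (b * c) = b * extBracket a c + c * extBracket a b := by
  have : rightBracket (b * c) =
      scaledDerivation b (rightBracket c) + scaledDerivation c (rightBracket b) := by
    apply derivation_ext'
    · intro g
      simp only [Derivation.add_apply, scaledDerivation_apply, rightBracket_apply,
        extBracket_pair, Derivation.leibniz, smul_eq_mul]
    · intro g
      simp only [Derivation.add_apply, scaledDerivation_apply, rightBracket_apply,
        extBracket_logGeod, Derivation.leibniz, smul_eq_mul]
    · simp only [Derivation.add_apply, scaledDerivation_apply, rightBracket_apply,
        extBracket_central, mul_zero, add_zero]
  exact DFunLike.congr_fun this a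

/-- The bracket with `a` on the left, as a derivation. -/
def leftBracket (a : LogExtension) : Derivation ℝ LogExtension LogExtension :=
  Derivation.mk'
    { toFun := extBracket a
      map_add' := extBracket_add_right a
      map_smul' := fun r b => extBracket_smul_right r a b } (extBracket_mul_right a)

theorem leftBracket_apply (a b : LogExtension) : leftBracket a b = extBracket a b := rfl

theorem leftBracket_pair (g : Geodesic) : leftBracket (lpair g.tgt g.src) = hamPair g := by
  refine Derivation.ext fun b => ?_
  exact extBracket_pair g b

theorem rightBracket_pair (g : Geodesic) : rightBracket (lpair g.tgt g.src) = -hamPair g := by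
  apply derivation_ext'
  · intro h
    rw [rightBracket_apply, extBracket_pair, hamPair_pair, Derivation.neg_apply, hamPair_pair,
      swapBracket_swap]
  · intro h
    rw [rightBracket_apply, extBracket_logGeod, hamLog_pair, Derivation.neg_apply,
      hamPair_logGeod, swapBracket_swap]
    ring
  · rw [rightBracket_apply, extBracket_central, Derivation.neg_apply, hamPair_central, neg_zero]

theorem rightBracket_logGeod (g : Geodesic) : rightBracket (logGeod g) = -hamLog g := by
  apply derivation_ext'
  · intro h
    rw [rightBracket_apply, extBracket_pair, hamPair_logGeod, Derivation.neg_apply, hamLog_pair,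
      swapBracket_swap]
    ring
  · intro h
    rw [rightBracket_apply, extBracket_logGeod, hamLog_logGeod, Derivation.neg_apply,
      hamLog_logGeod, swapBracket_swap, intersection_antisymm, neg_smul]
    ring
  · rw [rightBracket_apply, extBracket_central, Derivation.neg_apply, hamLog_central, neg_zero]

theorem rightBracket_central : rightBracket central = 0 := by
  apply derivation_ext'
  · intro h
    rw [rightBracket_apply, extBracket_pair, hamPair_central, Derivation.zero_apply]
  · intro h
    rw [rightBracket_apply, extBracket_logGeod, hamLog_central, Derivation.zero_apply]
  · rw [rightBracket_apply, extBracket_central, Derivation.zero_apply]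

/-- Antisymmetry with one argument a generator is the content of `rightBracket_pair`,
`rightBracket_logGeod` and `rightBracket_central`; comparing two derivations on generators then
frees the other argument. -/
theorem extBracket_swap (a b : LogExtension) : extBracket a b = -extBracket b a := by
  have : leftBracket a = -rightBracket a := by
    apply derivation_ext'
    · intro g
      rw [leftBracket_apply, Derivation.neg_apply, rightBracket_apply, extBracket_pair,
        ← rightBracket_apply, rightBracket_pair, Derivation.neg_apply]
    · intro g
      rw [leftBracket_apply, Derivation.neg_apply, rightBracket_apply, extBracket_logGeod,
        ← rightBracket_apply, rightBracket_logGeod, Derivation.neg_apply]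
    · rw [leftBracket_apply, Derivation.neg_apply, rightBracket_apply, extBracket_central,
        ← rightBracket_apply, rightBracket_central, Derivation.zero_apply, neg_zero]
  exact DFunLike.congr_fun this b

/-- The swapping bracket formula holds for all pairs of points, geodesic or not. -/
theorem extBracket_lpair_lpair (X x Y y : Boundary) :
    extBracket (lpair X x) (lpair Y y) =
      intersection (y, Y) (x, X) • (lpair X y * lpair Y x) := by
  -- For a phantom pair both sides vanish: the pair is `0` in the algebra and its intersection
  -- numbers are `0`.
  by_cases h1 : x = X
  · subst h1
    rw [lpair_self, ← rightBracket_apply, map_zero, intersection_antisymm, intersection_phantom,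
      neg_zero, zero_smul]
  by_cases h2 : y = Y
  · subst h2
    rw [lpair_self, ← leftBracket_apply, map_zero, intersection_phantom, zero_smul]
  have := extBracket_pair ⟨x, X, h1⟩ (lpair Y y)
  rw [this]
  exact hamPair_pair ⟨x, X, h1⟩ ⟨y, Y, h2⟩

theorem extBracket_lpair_logGeod (X x : Boundary) (h : Geodesic) :
    extBracket (lpair X x) (logGeod h) =
      intersection h.ends (x, X) • (linv h * (lpair X h.src * lpair h.tgt x)) := by
  by_cases h1 : x = X
  · subst h1
    rw [lpair_self, ← rightBracket_apply, map_zero, intersection_antisymm, intersection_phantom,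
      neg_zero, zero_smul]
  have := extBracket_pair ⟨x, X, h1⟩ (logGeod h)
  rw [this, hamPair_logGeod, swapBracket, mul_smul_comm]
  rfl

/-! ### The Jacobi identity for the extended swapping bracket -/

/-- `1` if the three points coincide, and `0` otherwise, written in terms of the signs of the
differences. -/
def tripleSign (a b c : Boundary) : ℝ :=
  cutSign a b * cutSign b c + cutSign b c * cutSign c a + cutSign c a * cutSign a b + 1

/-- For distinct points two of the cyclic signs agree and the third is opposite; if exactly two
points coincide, one sign is `0` and the others are opposite. The sum of products is `-1` in both
cases. -/
theorem tripleSign_eq_zero (a b c : Boundary) (h : ¬(a = b ∧ b = c)) : tripleSign a b c = 0 := by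
  have h' : ¬(cut a = cut b ∧ cut b = cut c) := fun h' =>
    h ⟨cut_injective h'.1, cut_injective h'.2⟩
  unfold tripleSign cutSign
  rcases lt_trichotomy (cut a) (cut b) with h1 | h1 | h1 <;>
  rcases lt_trichotomy (cut b) (cut c) with h2 | h2 | h2 <;>
  rcases lt_trichotomy (cut c) (cut a) with h3 | h3 | h3 <;>
  grind

/-- The alternating count of the coincidences between the ends of three pairs of points. -/
def coincidence (X x Y y Z z : Boundary) : ℝ :=
  (tripleSign X Y Z - tripleSign x Y Z - tripleSign X y Z - tripleSign X Y z
    + tripleSign X y z + tripleSign x Y z + tripleSign x y Z - tripleSign x y z) / 4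

/-- The total coefficient of `(X, z) (Y, x) (Z, y)` in the cyclic sum of double brackets;
`intersection_jacobi_right` does the same for the other monomial `(X, y) (Y, z) (Z, x)`. -/
theorem intersection_jacobi_left (X x Y y Z z : Boundary) :
    intersection (z, Z) (y, Y) * intersection (z, Y) (x, X) +
      intersection (x, X) (z, Z) * intersection (x, Z) (y, Y) +
      intersection (y, Y) (x, X) * intersection (y, X) (z, Z) =
      coincidence X x Y y Z z := by
  simp only [intersection_eq, coincidence, tripleSign, cutSign_swap X Y, cutSign_swap X Z,
    cutSign_swap X z, cutSign_swap x Y, cutSign_swap x y, cutSign_swap x Z, cutSign_swap x z,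
    cutSign_swap Y Z, cutSign_swap y Z, cutSign_swap y z]
  ring

theorem intersection_jacobi_right (X x Y y Z z : Boundary) :
    intersection (z, Z) (y, Y) * intersection (y, Z) (x, X) +
      intersection (x, X) (z, Z) * intersection (z, X) (y, Y) +
      intersection (y, Y) (x, X) * intersection (x, Y) (z, Z) =
      -coincidence X x Y y Z z := by
  simp only [intersection_eq, coincidence, tripleSign, cutSign_swap X Y, cutSign_swap X Z,
    cutSign_swap X z, cutSign_swap x Y, cutSign_swap x Z, cutSign_swap x z, cutSign_swap Y Z,
    cutSign_swap y Z]
  ring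

/-- If the three heads coincide, or the three tails, the two monomials are equal. If a coincidence
mixes heads and tails, each monomial contains a factor `p a a = 0`. -/
theorem coincidence_smul {A : Type*} [CommRing A] [Algebra ℝ A] (p : Boundary → Boundary → A)
    (hp : ∀ a, p a a = 0) (X x Y y Z z : Boundary) :
    coincidence X x Y y Z z • (p X z * p Y x * p Z y - p X y * p Y z * p Z x) = 0 := by
  have key : ∀ a b c, (a = b ∧ b = c → p X z * p Y x * p Z y = p X y * p Y z * p Z x) →
      tripleSign a b c • (p X z * p Y x * p Z y - p X y * p Y z * p Z x) = 0 := by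
    intro a b c h
    by_cases h' : a = b ∧ b = c
    · rw [h h', sub_self, smul_zero]
    · rw [tripleSign_eq_zero a b c h', zero_smul]
  have h1 := key X Y Z (by rintro ⟨rfl, rfl⟩; ring)
  have h2 := key x Y Z (by rintro ⟨rfl, rfl⟩; simp [hp])
  have h3 := key X y Z (by rintro ⟨rfl, rfl⟩; simp [hp])
  have h4 := key X Y z (by rintro ⟨rfl, rfl⟩; simp [hp])
  have h5 := key X y z (by rintro ⟨rfl, rfl⟩; simp [hp])
  have h6 := key x Y z (by rintro ⟨rfl, rfl⟩; simp [hp])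
  have h7 := key x y Z (by rintro ⟨rfl, rfl⟩; simp [hp])
  have h8 := key x y z (by rintro ⟨rfl, rfl⟩; ring)
  unfold coincidence
  rw [div_eq_inv_mul, mul_smul]
  simp only [add_smul, sub_smul _ _ (_ - _ : A), h1, h2, h3, h4, h5, h6, h7, h8, sub_zero, add_zero,
    smul_zero]

theorem hamPair_swapBracket (g h k : Geodesic) :
    hamPair g (swapBracket h k) = intersection k.ends h.ends •
      (intersection (k.src, h.tgt) g.ends •
          (lpair k.tgt h.src * (lpair g.tgt k.src * lpair h.tgt g.src)) +
        intersection (h.src, k.tgt) g.ends •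
          (lpair h.tgt k.src * (lpair g.tgt h.src * lpair k.tgt g.src))) := by
  rw [← leftBracket_pair, swapBracket, Derivation.map_smul, Derivation.leibniz,
    leftBracket_apply, leftBracket_apply, extBracket_lpair_lpair, extBracket_lpair_lpair,
    smul_eq_mul, smul_eq_mul, mul_smul_comm, mul_smul_comm, add_comm]
  rfl

theorem swapping_jacobi {A : Type*} [CommRing A] [Algebra ℝ A] (p : Boundary → Boundary → A)
    (hp : ∀ a, p a a = 0) (X x Y y Z z : Boundary) :
    intersection (z, Z) (y, Y) •
      (intersection (z, Y) (x, X) • (p Z y * (p X z * p Y x)) +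
        intersection (y, Z) (x, X) • (p Y z * (p X y * p Z x))) +
    intersection (x, X) (z, Z) •
      (intersection (x, Z) (y, Y) • (p X z * (p Y x * p Z y)) +
        intersection (z, X) (y, Y) • (p Z x * (p Y z * p X y))) +
    intersection (y, Y) (x, X) •
      (intersection (y, X) (z, Z) • (p Y x * (p Z y * p X z)) +
        intersection (x, Y) (z, Z) • (p X y * (p Z x * p Y z))) = 0 := by
  -- The six products are only two monomials, each occurring three times.
  have e1 : p Z y * (p X z * p Y x) = p X z * p Y x * p Z y := by ring
  have e2 : p Y z * (p X y * p Z x) = p X y * p Y z * p Z x := by ring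
  have e3 : p X z * (p Y x * p Z y) = p X z * p Y x * p Z y := by ring
  have e4 : p Z x * (p Y z * p X y) = p X y * p Y z * p Z x := by ring
  have e5 : p Y x * (p Z y * p X z) = p X z * p Y x * p Z y := by ring
  have e6 : p X y * (p Z x * p Y z) = p X y * p Y z * p Z x := by ring
  rw [e1, e2, e3, e4, e5, e6, ← coincidence_smul p hp X x Y y Z z, smul_sub, sub_eq_add_neg,
    ← neg_smul, ← intersection_jacobi_right, ← intersection_jacobi_left]
  module

theorem hamPair_jacobi (g h k : Geodesic) :
    hamPair g (swapBracket h k) + hamPair h (swapBracket k g) + hamPair k (swapBracket g h) =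
      0 := by
  rw [hamPair_swapBracket, hamPair_swapBracket, hamPair_swapBracket]
  exact swapping_jacobi lpair lpair_self g.tgt g.src h.tgt h.src k.tgt k.src

/-! ### Jacobi identity in the presence of logarithms -/

theorem hamPair_linv (g h : Geodesic) :
    hamPair g (linv h) = -(linv h * linv h * swapBracket g h) := by
  rw [derivation_linv, hamPair_pair]

theorem hamLog_linv (g h : Geodesic) :
    hamLog g (linv h) = -(linv h * linv h * (linv g * swapBracket g h)) := by
  rw [derivation_linv, hamLog_pair]

/-- On coefficients `ℓ_g` acts as the logarithm of `g`. This fails on the variables `ℓ_h`, because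
of the central term of `[ℓ_g, ℓ_h]`. -/
theorem hamLog_C (g : Geodesic) (f : SwapFraction) :
    hamLog g (MvPolynomial.C f) = linv g * hamPair g (MvPolynomial.C f) := by
  rw [← scaledDerivation_apply]
  apply derivation_C_ext
  intro h
  rw [scaledDerivation_apply, hamLog_pair, hamPair_pair]

theorem hamLog_swapBracket (g h k : Geodesic) :
    hamLog g (swapBracket h k) = linv g * hamPair g (swapBracket h k) := by
  rw [swapBracket, lpair, lpair, ← map_mul, Derivation.map_smul, Derivation.map_smul, hamLog_C,
    mul_smul_comm]

/-- The left side of the Jacobi identity. -/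
def jacobiator (a b c : LogExtension) : LogExtension :=
  extBracket a (extBracket b c) + extBracket b (extBracket c a) + extBracket c (extBracket a b)

theorem jacobiator_rotate (a b c : LogExtension) : jacobiator a b c = jacobiator b c a := by
  rw [jacobiator, jacobiator, add_assoc, add_comm]

theorem extBracket_neg_right (a b : LogExtension) : extBracket a (-b) = -extBracket a b :=
  (leftBracket a).map_neg b

theorem jacobiator_eq (a b c : LogExtension) : jacobiator a b c =
    (⁅leftBracket a, leftBracket b⁆ - leftBracket (extBracket a b)) c := by
  rw [Derivation.sub_apply, Derivation.commutator_apply, jacobiator, extBracket_swap c a,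
    extBracket_swap c (extBracket a b), extBracket_neg_right]
  simp only [leftBracket_apply, sub_eq_add_neg]

/-- With the first two arguments fixed, the jacobiator is a commutator of derivations minus a
derivation, so it is itself a derivation in the third. -/
theorem jacobiator_eq_zero_of_generators (a b : LogExtension)
    (hp : ∀ g : Geodesic, jacobiator a b (lpair g.tgt g.src) = 0)
    (hl : ∀ g : Geodesic, jacobiator a b (logGeod g) = 0) (c : LogExtension) :
    jacobiator a b c = 0 := by
  have : ⁅leftBracket a, leftBracket b⁆ - leftBracket (extBracket a b) = 0 := by
    apply derivation_ext'
    · intro g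
      rw [← jacobiator_eq, hp, Derivation.zero_apply]
    · intro g
      rw [← jacobiator_eq, hl, Derivation.zero_apply]
    · have h : ∀ d, extBracket d central = 0 := fun d => by
        rw [extBracket_swap, extBracket_central, neg_zero]
      rw [← jacobiator_eq, jacobiator, h, extBracket_central, extBracket_central,
        ← leftBracket_apply, ← leftBracket_apply, map_zero, map_zero, Derivation.zero_apply,
        add_zero, add_zero]
  rw [jacobiator_eq, this, Derivation.zero_apply]

theorem jacobiator_pair_pair_pair (g h k : Geodesic) :
    jacobiator (lpair g.tgt g.src) (lpair h.tgt h.src) (lpair k.tgt k.src) = 0 := by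
  simp only [jacobiator, extBracket_pair, hamPair_pair, hamPair_jacobi]

theorem jacobiator_pair_pair_log (g h k : Geodesic) :
    jacobiator (lpair g.tgt g.src) (lpair h.tgt h.src) (logGeod k) = 0 := by
  simp only [jacobiator, extBracket_pair, extBracket_logGeod, hamPair_pair, hamLog_pair,
    hamPair_logGeod, hamLog_swapBracket, Derivation.leibniz, smul_eq_mul, hamPair_linv]
  -- The other double brackets come from differentiating inverse weights; they cancel in pairs by
  -- antisymmetry of the swapping bracket.
  linear_combination linv k * hamPair_jacobi g h k -
    linv k ^ 2 * swapBracket h k * swapBracket_swap g k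

theorem jacobiator_pair_log_log (g h k : Geodesic) :
    jacobiator (lpair g.tgt g.src) (logGeod h) (logGeod k) = 0 := by
  simp only [jacobiator, extBracket_pair, extBracket_logGeod, hamLog_pair, hamPair_logGeod,
    hamLog_logGeod, hamLog_swapBracket, Derivation.leibniz, smul_eq_mul,
    hamPair_linv, hamLog_linv, map_add, Derivation.map_smul, hamPair_central, smul_zero]
  linear_combination linv h * linv k * hamPair_jacobi g h k -
    linv h * linv k ^ 2 * swapBracket h k * swapBracket_swap g k -
    linv h ^ 2 * linv k * swapBracket g h * swapBracket_swap h k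

theorem jacobiator_log_log_log (g h k : Geodesic) :
    jacobiator (logGeod g) (logGeod h) (logGeod k) = 0 := by
  simp only [jacobiator, extBracket_logGeod, hamLog_logGeod, hamLog_swapBracket, Derivation.leibniz,
    smul_eq_mul, hamLog_linv, map_add, Derivation.map_smul, hamLog_central, smul_zero]
  linear_combination linv g * linv h * linv k * hamPair_jacobi g h k -
    linv h * linv k * linv g ^ 2 * swapBracket k g * swapBracket_swap g h -
    linv h * linv k ^ 2 * linv g * swapBracket h k * swapBracket_swap g k -
    linv h ^ 2 * linv k * linv g * swapBracket g h * swapBracket_swap h k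

theorem jacobiator_eq_zero (a b c : LogExtension) : jacobiator a b c = 0 := by
  -- Cyclic symmetry brings each argument in turn to the last slot. The eight resulting cases are,
  -- up to rotation, the four computed above.
  refine jacobiator_eq_zero_of_generators a b
    (fun g => (jacobiator_rotate _ _ _).symm.trans
      (jacobiator_eq_zero_of_generators _ a
        (fun h => (jacobiator_rotate _ _ _).symm.trans
          (jacobiator_eq_zero_of_generators _ _ (fun k => ?_) (fun k => ?_) a))
        (fun h => (jacobiator_rotate _ _ _).symm.trans
          (jacobiator_eq_zero_of_generators _ _ (fun k => ?_) (fun k => ?_) a)) b))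
    (fun g => (jacobiator_rotate _ _ _).symm.trans
      (jacobiator_eq_zero_of_generators _ a
        (fun h => (jacobiator_rotate _ _ _).symm.trans
          (jacobiator_eq_zero_of_generators _ _ (fun k => ?_) (fun k => ?_) a))
        (fun h => (jacobiator_rotate _ _ _).symm.trans
          (jacobiator_eq_zero_of_generators _ _ (fun k => ?_) (fun k => ?_) a)) b)) c
  · exact jacobiator_pair_pair_pair _ _ _
  · exact jacobiator_pair_pair_log _ _ _
  · exact (jacobiator_rotate _ _ _).trans (jacobiator_pair_pair_log _ _ _)
  · exact (jacobiator_rotate _ _ _).trans (jacobiator_pair_log_log _ _ _)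
  · exact (jacobiator_rotate _ _ _).symm.trans (jacobiator_pair_pair_log _ _ _)
  · exact jacobiator_pair_log_log _ _ _
  · exact (jacobiator_rotate _ _ _).symm.trans (jacobiator_pair_log_log _ _ _)
  · exact jacobiator_log_log_log _ _ _

/-! ### Cyclic products attached to tuples of geodesics -/

/-- The starting point of the first geodesic (`∞` for the empty list). -/
def startPoint : List Geodesic → Boundary
  | [] => ∞
  | g :: _ => g.src

/-- The endpoint of the last geodesic (`∞` for the empty list). -/
def endPoint : List Geodesic → Boundary
  | [] => ∞
  | [g] => g.tgt
  | _ :: h :: l => endPoint (h :: l)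

@[simp] theorem startPoint_cons (g : Geodesic) (l : List Geodesic) :
    startPoint (g :: l) = g.src := rfl

@[simp] theorem endPoint_singleton (g : Geodesic) : endPoint [g] = g.tgt := rfl

theorem endPoint_cons (g : Geodesic) {l : List Geodesic} (hl : l ≠ []) :
    endPoint (g :: l) = endPoint l := by
  cases l with
  | nil => exact absurd rfl hl
  | cons h l => rfl

theorem startPoint_append {l : List Geodesic} (hl : l ≠ []) (m : List Geodesic) :
    startPoint (l ++ m) = startPoint l := by
  cases l with
  | nil => exact absurd rfl hl
  | cons h l => rfl

theorem endPoint_append (l : List Geodesic) {m : List Geodesic} (hm : m ≠ []) :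
    endPoint (l ++ m) = endPoint m := by
  induction l with
  | nil => rfl
  | cons g l ih => rw [List.cons_append, endPoint_cons _ (by simp [hm]), ih]

theorem endPoint_eq_getLast (l : List Geodesic) (hl : l ≠ []) :
    endPoint l = (l.getLast hl).tgt := by
  induction l with
  | nil => exact absurd rfl hl
  | cons g l ih =>
    cases l with
    | nil => rfl
    | cons h l => rw [endPoint_cons _ (by simp), ih (by simp),
        List.getLast_cons (List.cons_ne_nil h l)]

section Loop

variable {R : Type*} [CommRing R] (p : Boundary → Boundary → R) (i : Geodesic → R)

/-- The product of the weights `i g` of the entries and of the weights `p (g⁺, h⁻)` of the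
consecutive pairs. -/
def path : List Geodesic → R
  | [] => 1
  | [g] => i g
  | g :: h :: l => i g * p g.tgt h.src * path (h :: l)

/-- The cyclic version of `path`. -/
def loop (l : List Geodesic) : R := path p i l * p (endPoint l) (startPoint l)

theorem path_singleton (g : Geodesic) : path p i [g] = i g := by rw [path]

theorem path_cons (g : Geodesic) {l : List Geodesic} (hl : l ≠ []) :
    path p i (g :: l) = i g * p g.tgt (startPoint l) * path p i l := by
  cases l with
  | nil => exact absurd rfl hl
  | cons h l => rw [path]; rfl

theorem path_append {l m : List Geodesic} (hl : l ≠ []) (hm : m ≠ []) :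
    path p i (l ++ m) = path p i l * p (endPoint l) (startPoint m) * path p i m := by
  induction l with
  | nil => exact absurd rfl hl
  | cons g l ih =>
    rcases eq_or_ne l [] with rfl | hl'
    · rw [List.singleton_append, path_cons p i g hm, path_singleton, endPoint_singleton]
    · rw [List.cons_append, path_cons p i g (by simp [hl']), ih hl', path_cons p i g hl',
        startPoint_append hl', endPoint_cons g hl']
      ring

theorem loop_append {l m : List Geodesic} (hl : l ≠ []) (hm : m ≠ []) :
    loop p i (l ++ m) = path p i l * p (endPoint l) (startPoint m) * path p i m *
      p (endPoint m) (startPoint l) := by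
  rw [loop, path_append p i hl hm, startPoint_append hl, endPoint_append l hm]

/-- A rotation exchanges the two parts of a concatenation, so this makes `loop` well defined on
configurations. -/
theorem loop_append_comm (l m : List Geodesic) : loop p i (l ++ m) = loop p i (m ++ l) := by
  rcases eq_or_ne l [] with rfl | hl
  · simp
  rcases eq_or_ne m [] with rfl | hm
  · simp
  rw [loop_append p i hl hm, loop_append p i hm hl]
  ring

theorem loop_cons (g : Geodesic) {l : List Geodesic} (hl : l ≠ []) :
    loop p i (g :: l) =
      i g * p g.tgt (startPoint l) * path p i l * p (endPoint l) g.src := by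
  rw [← List.singleton_append, loop_append p i (by simp) hl, path_singleton, endPoint_singleton,
    startPoint_cons]

theorem loop_eq_of_isRotated {l m : List Geodesic} (h : l ~r m) : loop p i l = loop p i m := by
  obtain ⟨n, rfl⟩ := h
  rw [← List.rotate_mod, List.rotate_eq_drop_append_take_mod, loop_append_comm]
  simp

/-- The cyclic product of a configuration. -/
def Configuration.loop (G : Configuration) : R :=
  Quotient.lift (GhostSwap.loop p i) (by
    rintro l m h
    exact loop_eq_of_isRotated p i h) G.1

theorem Configuration.loop_config (l : List Geodesic) (h : l ≠ []) :
    (config l h).loop p i = GhostSwap.loop p i l := rfl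

theorem Configuration.exists_eq_config (G : Configuration) : ∃ l h, G = config l h := by
  obtain ⟨c, hc⟩ := G
  induction c using Quotient.inductionOn with
  | h l => exact ⟨l, fun h => hc (by subst h; rfl), rfl⟩

theorem map_path {S : Type*} [CommRing S] (f : R →+* S) (l : List Geodesic) :
    f (path p i l) = path (fun X x => f (p X x)) (fun g => f (i g)) l := by
  induction l with
  | nil => simp [path]
  | cons g l ih =>
    rcases eq_or_ne l [] with rfl | hl
    · simp [path]
    · rw [path_cons _ _ g hl, path_cons _ _ g hl, map_mul, map_mul, ih]

theorem Configuration.map_loop {S : Type*} [CommRing S] (f : R →+* S) (G : Configuration) :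
    f (G.loop p i) = G.loop (fun X x => f (p X x)) (fun g => f (i g)) := by
  obtain ⟨l, h, rfl⟩ := G.exists_eq_config
  rw [loop_config, loop_config, GhostSwap.loop, map_mul, map_path]
  rfl

/-! ### Cyclic products as multifractions -/

theorem path_eq_prod (g : Geodesic) (l : List Geodesic) :
    path p i (g :: l) = (∏ k : Fin (l.length + 1), i ((g :: l).get k)) *
      ∏ k : Fin l.length, p ((g :: l).get k.castSucc).tgt (l.get k).src := by
  induction l generalizing g with
  | nil => simp [path]
  | cons h l ih =>
    rw [path_cons p i g (by simp), ih h]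
    simp only [List.length_cons]
    rw [Fin.prod_univ_succ (n := l.length + 1), Fin.prod_univ_succ (n := l.length)
      (fun k => p ((g :: h :: l).get k.castSucc).tgt ((h :: l).get k).src)]
    simp only [List.get_eq_getElem, Fin.val_zero, List.getElem_cons_zero, Fin.val_succ,
      List.getElem_cons_succ, Fin.val_castSucc, startPoint_cons]
    ring

theorem loop_eq_prod (l : List Geodesic) (hl : l ≠ []) :
    loop p i l = ∏ k : Fin l.length,
      (i (l.get k) * p (l.get k).tgt (l.get (finRotate l.length k)).src) := by
  cases l with
  | nil => exact absurd rfl hl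
  | cons g l =>
    rw [loop, path_eq_prod, Finset.prod_mul_distrib, mul_assoc]
    congr 1
    simp only [List.length_cons]
    rw [Fin.prod_univ_castSucc (n := l.length)]
    congr 1
    · refine Finset.prod_congr rfl fun k _ => ?_
      rw [show finRotate (l.length + 1) k.castSucc = k.succ by simp]
      rfl
    -- The last index is sent back to `0`, which gives the closing factor of the loop.
    · rw [finRotate_last, endPoint_eq_getLast _ (by simp), List.getLast_eq_getElem]
      rfl

/-! ### Cyclic products under orientation reversal -/

theorem startPoint_map_rev_reverse {l : List Geodesic} (hl : l ≠ []) :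
    startPoint (l.map Geodesic.rev).reverse = endPoint l := by
  induction l with
  | nil => exact absurd rfl hl
  | cons g l ih =>
    rcases eq_or_ne l [] with rfl | hl'
    · rfl
    · rw [List.map_cons, List.reverse_cons, startPoint_append (by simpa using hl'), ih hl',
        endPoint_cons g hl']

theorem endPoint_map_rev_reverse {l : List Geodesic} (hl : l ≠ []) :
    endPoint (l.map Geodesic.rev).reverse = startPoint l := by
  cases l with
  | nil => exact absurd rfl hl
  | cons g l =>
    rw [List.map_cons, List.reverse_cons, endPoint_append _ (by simp)]
    rfl

theorem path_map_rev_reverse (l : List Geodesic) :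
    path p i (l.map Geodesic.rev).reverse =
      path (fun X x => p x X) (fun g => i g.rev) l := by
  induction l with
  | nil => simp [path]
  | cons g l ih =>
    rcases eq_or_ne l [] with rfl | hl
    · simp [path]
    · rw [List.map_cons, List.reverse_cons, path_append p i (by simpa using hl) (by simp),
        endPoint_map_rev_reverse hl, ih, path_cons _ _ g hl, path_singleton, startPoint_cons,
        Geodesic.rev]
      ring

theorem Configuration.loop_rev (G : Configuration) :
    G.rev.loop p i = G.loop (fun X x => p x X) (fun g => i g.rev) := by
  obtain ⟨l, h, rfl⟩ := G.exists_eq_config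
  change GhostSwap.loop p i (l.map Geodesic.rev).reverse = GhostSwap.loop _ _ l
  rw [GhostSwap.loop, path_map_rev_reverse, endPoint_map_rev_reverse h,
    startPoint_map_rev_reverse h]
  rfl

end Loop

/-! ### The Leibniz rule for cyclic products -/

section Leibniz

variable {R : Type*} [CommRing R] [Algebra ℝ R] (p : Boundary → Boundary → R) (i : Geodesic → R)
  (D : Derivation ℝ R R)

/-- The contribution to the derivative of a cyclic product of the two edges attached to an ordered
representative. -/
def leibnizTerm (m : List Geodesic) : R :=
  ((edgesAt m).map fun θ => -θ.sign • (path p i θ.opp * D (p θ.ends.2 θ.ends.1))).sum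

/-- The opposite tuple of the visible edge repeats `g` at its end, so its path is the whole loop
times one more weight `i g`. With the sign this is what differentiating the inverse weight of `g`
gives; the ghost edge accounts for the closing join. -/
theorem leibnizTerm_cons (g : Geodesic) (l : List Geodesic) :
    leibnizTerm p i D (g :: l) =
      path p i (g :: l) * D (p (endPoint (g :: l)) g.src) -
        path p i (g :: l) * p (endPoint (g :: l)) g.src * i g * D (p g.tgt g.src) := by
  have h := path_append p i (l := g :: l) (m := [g]) (by simp) (by simp)
  rw [path_singleton, startPoint_cons] at h
  rw [leibnizTerm, edgesAt, ← h]
  simp only [Multiset.insert_eq_cons, Multiset.map_cons, Multiset.sum_cons,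
    Multiset.map_singleton, Multiset.sum_singleton, Geodesic.ends,
    endPoint_eq_getLast (g :: l) (by simp), neg_neg, one_smul, neg_smul]
  ring

variable {p i D}

/-- The rotation starting at an entry of `v` carries the derivatives of the join before that entry
and of its weight. Together these exhaust the join from `u` to `v` and the path of `v`. -/
theorem derivation_path_aux (hD : ∀ g, D (i g) = -(i g * i g * D (p g.tgt g.src)))
    {u v : List Geodesic} (hu : u ≠ []) (hv : v ≠ []) :
    path p i u * D (p (endPoint u) (startPoint v) * path p i v) *
        p (endPoint v) (startPoint u) =
      ∑ k ∈ Finset.range v.length, leibnizTerm p i D ((v ++ u).rotate k) := by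
  induction v generalizing u with
  | nil => exact absurd rfl hv
  | cons h v ih =>
    rw [List.length_cons, Finset.sum_range_succ', List.rotate_zero]
    simp only [List.cons_append, List.rotate_cons_succ, List.append_assoc]
    rw [leibnizTerm_cons, endPoint_cons h (l := v ++ u) (by simp [hu]), endPoint_append v hu]
    rcases eq_or_ne v [] with rfl | hv'
    · rw [List.length_nil, Finset.sum_range_zero, List.nil_append, path_cons p i h hu,
        path_singleton, startPoint_cons, endPoint_singleton, D.leibniz, hD, smul_eq_mul,
        smul_eq_mul]
      ring
    -- Once the terms of `h` are split off, `h` passes to the undifferentiated part `u`.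
    · rw [← ih (u := u ++ [h]) (by simp) hv', path_append p i hu (by simp), path_singleton,
        endPoint_append u (by simp), startPoint_append hu, endPoint_cons h hv',
        path_cons p i h (l := v ++ u) (by simp [hu]), startPoint_append hv',
        path_append p i hv' hu, path_cons p i h hv']
      simp only [startPoint_cons, endPoint_singleton, D.leibniz, hD, smul_eq_mul]
      ring

theorem derivation_loop (hD : ∀ g, D (i g) = -(i g * i g * D (p g.tgt g.src)))
    {l : List Geodesic} (hl : l ≠ []) :
    D (loop p i l) = ∑ k ∈ Finset.range l.length, leibnizTerm p i D (l.rotate k) := by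
  cases l with
  | nil => exact absurd rfl hl
  | cons g l =>
    rw [List.length_cons, Finset.sum_range_succ', List.rotate_zero, leibnizTerm_cons]
    simp only [List.rotate_cons_succ]
    rcases eq_or_ne l [] with rfl | hl'
    · rw [List.length_nil, Finset.sum_range_zero, loop, path_singleton, startPoint_cons,
        endPoint_singleton, D.leibniz, hD, smul_eq_mul, smul_eq_mul]
      ring
    -- The rotation by `0` gives the closing join and the weight of `g`; all other factors are
    -- covered with `u = [g]`.
    · rw [← derivation_path_aux hD (by simp) hl', loop_cons p i g hl', path_cons p i g hl',
        endPoint_cons g hl', path_singleton]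
      simp only [startPoint_cons, endPoint_singleton, D.leibniz, hD, smul_eq_mul]
      ring

theorem cyclicPermutations_eq_map_range {α : Type*} {l : List α} (hl : l ≠ []) :
    l.cyclicPermutations = (List.range l.length).map l.rotate := by
  apply List.ext_getElem
  · simp [List.length_cyclicPermutations_of_ne_nil l hl]
  · intro n h1 h2
    simp [List.getElem_cyclicPermutations]

theorem Configuration.derivation_loop (hD : ∀ g, D (i g) = -(i g * i g * D (p g.tgt g.src)))
    (G : Configuration) :
    D (G.loop p i) =
      (G.edges.map fun θ => -θ.sign • (path p i θ.opp * D (p θ.ends.2 θ.ends.1))).sum := by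
  obtain ⟨l, h, rfl⟩ := G.exists_eq_config
  rw [loop_config, GhostSwap.derivation_loop hD h, Configuration.edges, config, Cycle.lists_coe,
    cyclicPermutations_eq_map_range h, Multiset.map_bind, Multiset.sum_bind]
  simp only [Multiset.map_coe, Multiset.sum_coe, List.map_map]
  rw [Finset.sum, Finset.range_val, Multiset.range, Multiset.map_coe, Multiset.sum_coe]
  rfl

end Leibniz

theorem Configuration.ends_of_mem_edges {G : Configuration} {θ : PolygonEdge}
    (h : θ ∈ G.edges) : θ.ends = (startPoint θ.opp, endPoint θ.opp) := by
  obtain ⟨m, -, hm⟩ := Multiset.mem_bind.1 h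
  cases m with
  | nil => exact absurd hm (Multiset.notMem_zero _)
  | cons g l =>
    simp only [edgesAt, Multiset.insert_eq_cons, Multiset.mem_cons, Multiset.mem_singleton] at hm
    rcases hm with rfl | rfl
    · simp only [Geodesic.ends, List.cons_append, startPoint_cons]
      rw [← List.cons_append, endPoint_append _ (by simp), endPoint_singleton]
    · simp only [startPoint_cons, endPoint_eq_getLast (g :: l) (by simp)]

/-! ### The homomorphism from the ghost algebra to the log extension -/

/-- The image of a generator of the ghost algebra. -/
def genImage : GhostGen → LogExtension
  | .casimir => central
  | .geodesic g => logGeod g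
  | .polygon G => G.loop lpair linv

/-- The homomorphism of the theorem, with values in the log extension. -/
def ghostMap : GhostAlgebra →ₐ[ℝ] LogExtension := MvPolynomial.aeval genImage

theorem ghostMap_X (s : GhostGen) : ghostMap (MvPolynomial.X s) = genImage s :=
  MvPolynomial.aeval_X _ _

theorem ghostMap_poly (l : List Geodesic) (h : l ≠ []) :
    ghostMap (poly l h) = loop lpair linv l :=
  ghostMap_X _

theorem extBracket_polygon_left (G : Configuration) (b : LogExtension) :
    extBracket (G.loop lpair linv) b = (G.edges.map fun θ =>
      -θ.sign • (path lpair linv θ.opp * extBracket (lpair θ.ends.2 θ.ends.1) b)).sum :=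
  G.derivation_loop (D := rightBracket b) (derivation_linv _)

theorem extBracket_polygon_right (a : LogExtension) (G : Configuration) :
    extBracket a (G.loop lpair linv) = (G.edges.map fun θ =>
      -θ.sign • (path lpair linv θ.opp * extBracket a (lpair θ.ends.2 θ.ends.1))).sum :=
  G.derivation_loop (D := leftBracket a) (derivation_linv _)

theorem extBracket_central_right (a : LogExtension) : extBracket a central = 0 := by
  rw [extBracket_swap, extBracket_central, neg_zero]

theorem ghostMap_multiset_sum (s : Multiset GhostAlgebra) :
    ghostMap s.sum = (s.map ghostMap).sum :=
  map_multiset_sum ghostMap s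

theorem ghostMap_genBracket_polygon_geodesic (G : Configuration) (h : Geodesic) :
    extBracket (G.loop lpair linv) (logGeod h) =
      ghostMap (genBracket (.polygon G) (.geodesic h)) := by
  rw [extBracket_polygon_left, genBracket, ghostMap_multiset_sum, Multiset.map_map]
  congr 1
  refine Multiset.map_congr rfl fun θ hθ => ?_
  rw [Function.comp_apply, map_smul, ghostMap_poly, loop_cons lpair linv h θ.opp_ne,
    extBracket_lpair_logGeod, Configuration.ends_of_mem_edges hθ, mul_smul, mul_smul_comm]
  congr 2
  ring

theorem extBracket_genImage (s t : GhostGen) :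
    extBracket (genImage s) (genImage t) = ghostMap (genBracket s t) := by
  cases s with
  | casimir => rw [genImage, extBracket_central, genBracket, map_zero]
  | geodesic g =>
    cases t with
    | casimir =>
      change extBracket _ central = ghostMap 0
      rw [extBracket_central_right, map_zero]
    -- The loop of `(h, g)` is `[g, h] / (g h)` without its intersection number, and `-ε(h, g)` in
    -- front of the Casimir element is `ε(g, h)`.
    | geodesic h =>
      rw [genImage, genImage, extBracket_logGeod, hamLog_logGeod, genBracket, map_smul, map_sub,
        ghostMap_poly, loop_cons lpair linv h (by simp), path_singleton, endPoint_singleton,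
        startPoint_cons, casimir, ghostMap_X, genImage, swapBracket, smul_sub,
        intersection_antisymm g.ends, neg_smul, mul_smul_comm, sub_eq_add_neg]
      congr 2
      ring
    | polygon H =>
      rw [genImage, genImage, extBracket_swap, ghostMap_genBracket_polygon_geodesic, genBracket,
        genBracket, map_neg]
  | polygon G =>
    cases t with
    | casimir =>
      change extBracket _ central = ghostMap 0
      rw [extBracket_central_right, map_zero]
    | geodesic h => exact ghostMap_genBracket_polygon_geodesic G h
    | polygon H =>
      rw [genImage, genImage, extBracket_polygon_left, genBracket, ghostMap_multiset_sum,
        Multiset.map_map]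
      congr 1
      refine Multiset.map_congr rfl fun θ hθ => ?_
      rw [Function.comp_apply, ghostMap_multiset_sum, Multiset.map_map,
        extBracket_polygon_right, ← Multiset.sum_map_mul_left, Multiset.smul_sum,
        Multiset.map_map]
      congr 1
      refine Multiset.map_congr rfl fun σ hσ => ?_
      rw [Function.comp_apply, Function.comp_apply, map_smul, ghostMap_poly,
        loop_append lpair linv θ.opp_ne σ.opp_ne, extBracket_lpair_lpair,
        Configuration.ends_of_mem_edges hθ, Configuration.ends_of_mem_edges hσ,
        mul_smul_comm, mul_smul_comm, mul_smul_comm, smul_smul, smul_smul]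
      congr 1
      · ring
      · ring

theorem extBracket_ghostMap (A B : GhostAlgebra) :
    extBracket (ghostMap A) (ghostMap B) = ghostMap (ghostBracket A B) := by
  have hB : ∀ s, extBracket (genImage s) (ghostMap B) =
      ghostMap (MvPolynomial.mkDerivation ℝ (fun t => genBracket s t) B) := by
    intro s
    rw [← leftBracket_apply]
    induction B using MvPolynomial.induction_on with
    | C r =>
      rw [MvPolynomial.derivation_C, map_zero]
      exact (congrArg _ (ghostMap.commutes r)).trans (Derivation.map_algebraMap _ r)
    | add p q hp hq => simp only [map_add, hp, hq]
    | mul_X p t hp =>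
      rw [map_mul, Derivation.leibniz, hp, ghostMap_X, leftBracket_apply, extBracket_genImage,
        Derivation.leibniz, MvPolynomial.mkDerivation_X]
      simp only [smul_eq_mul, map_add, map_mul, ghostMap_X]
  rw [ghostBracket, ← rightBracket_apply]
  induction A using MvPolynomial.induction_on with
  | C r =>
    rw [MvPolynomial.derivation_C, map_zero]
    exact (congrArg _ (ghostMap.commutes r)).trans (Derivation.map_algebraMap _ r)
  | add p q hp hq => simp only [map_add, hp, hq]
  | mul_X p t hp =>
    rw [map_mul, Derivation.leibniz, hp, ghostMap_X, rightBracket_apply, hB,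
      Derivation.leibniz, MvPolynomial.mkDerivation_X]
    simp only [smul_eq_mul, map_add, map_mul, ghostMap_X]

/-! ### Orientation reversal -/

theorem fractionReverse_algebraMap (q : SwapAlgebra) :
    fractionReverse (algebraMap SwapAlgebra SwapFraction q) =
      algebraMap SwapAlgebra SwapFraction (MvPolynomial.rename Geodesic.rev q) :=
  IsLocalization.lift_eq _ _

theorem extReverse_C (f : SwapFraction) :
    extReverse (MvPolynomial.C f) = MvPolynomial.C (fractionReverse f) :=
  MvPolynomial.aevalTower_C _ _ _

theorem extReverse_X (o : Option Geodesic) :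
    extReverse (MvPolynomial.X o) = MvPolynomial.X (o.map Geodesic.rev) :=
  MvPolynomial.aevalTower_X _ _ _

theorem rename_rev_pair (X x : Boundary) :
    MvPolynomial.rename Geodesic.rev (pair X x) = pair x X := by
  unfold pair
  by_cases h : x = X
  · simp [h]
  · rw [dif_pos h, dif_pos (Ne.symm h), MvPolynomial.rename_X]
    rfl

theorem fractionReverse_fpair (X x : Boundary) : fractionReverse (fpair X x) = fpair x X := by
  rw [fpair, fractionReverse_algebraMap, rename_rev_pair, fpair]

theorem extReverse_lpair (X x : Boundary) : extReverse (lpair X x) = lpair x X := by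
  rw [lpair, extReverse_C, fractionReverse_fpair, lpair]

theorem extReverse_linv (g : Geodesic) : extReverse (linv g) = linv g.rev := by
  rw [linv, extReverse_C, map_inv₀, fractionReverse_fpair]
  rfl

theorem extReverse_ghostMap (A : GhostAlgebra) :
    extReverse (ghostMap A) = ghostMap (ghostReverse A) := by
  have h : extReverse.comp ghostMap = ghostMap.comp ghostReverse := by
    refine MvPolynomial.algHom_ext fun s => ?_
    rw [AlgHom.comp_apply, AlgHom.comp_apply, ghostReverse, MvPolynomial.rename_X, ghostMap_X,
      ghostMap_X]
    cases s with
    | casimir => exact extReverse_X none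
    | geodesic g => exact extReverse_X (some g)
    | polygon G =>
      change extReverse.toRingHom (G.loop lpair linv) = G.rev.loop lpair linv
      rw [Configuration.map_loop, Configuration.loop_rev]
      congr
      · funext X x
        exact extReverse_lpair X x
      · funext g
        exact extReverse_linv g
  exact DFunLike.congr_fun h A

/-! ### The image of the homomorphism -/

theorem lmulti_eq_prod {n : ℕ} (g : Fin n → Geodesic) (σ : Equiv.Perm (Fin n)) :
    lmulti g σ = ∏ k, (linv (g k) * lpair (g k).tgt (g (σ k)).src) := by
  simp only [lmulti, multifraction, linv, lpair, ← map_mul, ← map_prod, div_eq_mul_inv,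
    Finset.prod_mul_distrib, Finset.prod_inv_distrib]
  rw [mul_comm]

theorem loop_eq_lmulti (l : List Geodesic) (hl : l ≠ []) :
    loop lpair linv l = lmulti l.get (finRotate l.length) := by
  rw [loop_eq_prod _ _ l hl, lmulti_eq_prod]

theorem val_finRotate {n : ℕ} (k : Fin n) : (finRotate n k : ℕ) = (k + 1) % n := by
  cases n with
  | zero => exact k.elim0
  | succ n => rw [finRotate_apply, Fin.val_add, Fin.val_one', Nat.add_mod_mod]

/-- A fixed index contributes `g⁻¹ g = 1`, so only the support matters; listing it in cyclic order
gives one configuration. The permutation acts on indices, so repeated geodesics do no harm. -/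
theorem prod_mem_range_of_isCycle {ι : Type*} [Fintype ι] [DecidableEq ι] (g : ι → Geodesic)
    {σ : Equiv.Perm ι} (hσ : σ.IsCycle) :
    ∏ k, (linv (g k) * lpair (g k).tgt (g (σ k)).src) ∈ ghostMap.range := by
  obtain ⟨c, ⟨hc, rfl⟩, -⟩ := hσ.existsUnique_cycle
  induction c using Quotient.inductionOn with
  | h l =>
    change l.Nodup at hc
    have hl : l ≠ [] := by
      rintro rfl
      exact Equiv.Perm.not_isCycle_one hσ
    refine ⟨poly (l.map g) (by simpa using hl), ?_⟩
    have hlen : (l.map g).length = l.length := List.length_map g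
    change ghostMap (poly (l.map g) _) = _
    rw [ghostMap_poly, loop_eq_prod _ _ _ (by simpa using hl)]
    have h1 : ∀ x, x ∉ l.toFinset →
        linv (g x) * lpair (g x).tgt (g (l.formPerm x)).src = 1 := by
      intro x hx
      rw [List.formPerm_apply_of_notMem (by simpa using hx), mul_comm, lpair_mul_linv]
    change _ = ∏ k, (linv (g k) * lpair (g k).tgt (g (l.formPerm k)).src)
    rw [← Finset.prod_subset (Finset.subset_univ l.toFinset) (fun x _ hx => h1 x hx),
      List.prod_toFinset _ hc, ← Fin.prod_univ_fun_getElem]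
    refine Fintype.prod_equiv (finCongr hlen) _ _ fun k => ?_
    have h2 : ((finRotate (l.map g).length k : Fin _) : ℕ) = (k + 1) % l.length := by
      rw [← hlen]
      exact val_finRotate k
    simp only [List.get_eq_getElem, List.getElem_map, h2, finCongr_apply, Fin.val_cast,
      List.formPerm_apply_getElem l hc]

theorem prod_mem_range {ι : Type*} [Fintype ι] [DecidableEq ι] (g : ι → Geodesic)
    (σ : Equiv.Perm ι) :
    ∏ k, (linv (g k) * lpair (g k).tgt (g (σ k)).src) ∈ ghostMap.range := by
  induction σ using Equiv.Perm.cycle_induction_on with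
  | base_one =>
    have : ∀ k, linv (g k) * lpair (g k).tgt (g k).src = 1 := fun k => by
      rw [mul_comm, lpair_mul_linv]
    simp [this]
  | base_cycles σ hσ => exact prod_mem_range_of_isCycle g hσ
  | induction_disjoint σ τ h _ hσ hτ =>
    have := mul_mem hσ hτ
    rw [← Finset.prod_mul_distrib] at this
    convert this using 2 with k
    have e : linv (g k) * lpair (g k).tgt (g k).src = 1 := by rw [mul_comm, lpair_mul_linv]
    -- Every index is fixed by one of the two disjoint permutations, whose factor there is `1`.
    rcases h k with hk | hk
    · rw [hk, e, one_mul, h.commute.eq, Equiv.Perm.mul_apply, hk]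
    · rw [hk, e, mul_one, Equiv.Perm.mul_apply, hk]

theorem range_ghostMap : ghostMap.range = extendedSwapping := by
  apply le_antisymm
  · rw [ghostMap, ← Algebra.adjoin_range_eq_range_aeval]
    refine Algebra.adjoin_mono ?_
    rintro _ ⟨s, rfl⟩
    cases s with
    | casimir => exact Or.inr rfl
    | geodesic g => exact Or.inl (Or.inr ⟨g, rfl⟩)
    | polygon G =>
      obtain ⟨l, hl, rfl⟩ := G.exists_eq_config
      exact Or.inl (Or.inl ⟨_, _, _, loop_eq_lmulti l hl⟩)
  · refine Algebra.adjoin_le ?_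
    rintro _ ((⟨n, g, σ, rfl⟩ | ⟨g, rfl⟩) | rfl)
    · rw [lmulti_eq_prod]
      exact prod_mem_range g σ
    · exact ⟨geod g, ghostMap_X _⟩
    · exact ⟨casimir, ghostMap_X _⟩

/-! ### Correlation functions factor through the homomorphism -/

section Correlation

variable {V : Type*} [NormedAddCommGroup V] [NormedSpace ℝ V]
  (ξ : Boundary → ℙ ℝ V) (ξ' : Boundary → ℙ ℝ (V →L[ℝ] ℝ))

/-- The pairing of representatives of `ξ X` and `ξ' x`. -/
def limitPairing (X x : Boundary) : ℝ := (ξ' x).rep (ξ X).rep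

/-- A composite of rank-one maps has rank at most one: the covector comes from the first geodesic,
the vector from the last, and each intermediate pairing is a join. -/
theorem prod_projector (l : List Geodesic) (hl : l ≠ []) :
    (l.reverse.map (projector ξ ξ')).prod =
      path (limitPairing ξ ξ') (fun g => (limitPairing ξ ξ' g.tgt g.src)⁻¹) l •
        ((ξ' (startPoint l)).rep : V →ₗ[ℝ] ℝ).smulRight (ξ (endPoint l)).rep := by
  induction l with
  | nil => exact absurd rfl hl
  | cons g l ih =>
    rcases eq_or_ne l [] with rfl | hl'
    · simp [path_singleton, projector, limitPairing]
    · rw [List.reverse_cons, List.map_append, List.prod_append, ih hl', path_cons _ _ g hl',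
        endPoint_cons g hl', startPoint_cons]
      ext w
      simp only [List.map_cons, List.map_nil, List.prod_singleton, Module.End.mul_apply,
        projector, LinearMap.smul_apply, LinearMap.smulRight_apply, ContinuousLinearMap.coe_coe,
        map_smul, smul_smul, limitPairing]
      congr 1
      ring

/-- The trace of `φ ⊗ v` is `φ v`, which closes the path. -/
theorem listTrace_eq_loop [FiniteDimensional ℝ V] (l : List Geodesic) (hl : l ≠ []) :
    listTrace ξ ξ' l =
      loop (limitPairing ξ ξ') (fun g => (limitPairing ξ ξ' g.tgt g.src)⁻¹) l := by
  rw [listTrace, prod_projector ξ ξ' l hl, map_smul, LinearMap.trace_smulRight, loop]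
  rfl

/-- The evaluation of the swapping algebra at the pairing of the limit maps. -/
def pairingEval : SwapAlgebra →ₐ[ℝ] ℝ :=
  MvPolynomial.aeval fun g => limitPairing ξ ξ' g.tgt g.src

/-- The elements of the swapping algebra that do not vanish at the pairing of the limit maps. -/
def pairingUnits : Submonoid SwapAlgebra := (nonZeroDivisors ℝ).comap (pairingEval ξ ξ')

theorem pairingUnits_le : pairingUnits ξ ξ' ≤ nonZeroDivisors SwapAlgebra := by
  intro q hq
  rw [mem_nonZeroDivisors_iff_ne_zero]
  rintro rfl
  exact nonZeroDivisors.ne_zero (show pairingEval ξ ξ' 0 ∈ nonZeroDivisors ℝ from hq) (map_zero _)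

/-- The fractions that can be evaluated at the pairing of the limit maps. -/
abbrev RegularFraction : Type := Localization (pairingUnits ξ ξ')

/-- The inclusion of the regular fractions in the fraction algebra. -/
def regularInclusion : RegularFraction ξ ξ' →ₐ[ℝ] SwapFraction :=
  IsLocalization.liftAlgHom (M := pairingUnits ξ ξ')
    (f := IsScalarTower.toAlgHom ℝ SwapAlgebra SwapFraction)
    (fun y => IsLocalization.map_units SwapFraction
      (⟨y.1, pairingUnits_le ξ ξ' y.2⟩ : nonZeroDivisors SwapAlgebra))

/-- The evaluation of the regular fractions. -/
def regularEval : RegularFraction ξ ξ' →ₐ[ℝ] ℝ :=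
  IsLocalization.liftAlgHom (M := pairingUnits ξ ξ') (f := pairingEval ξ ξ')
    (fun y => (nonZeroDivisors.ne_zero (show pairingEval ξ ξ' y ∈ nonZeroDivisors ℝ from
      y.2)).isUnit)

theorem regularInclusion_algebraMap (q : SwapAlgebra) :
    regularInclusion ξ ξ' (algebraMap _ _ q) = algebraMap SwapAlgebra SwapFraction q :=
  IsLocalization.lift_eq _ _

theorem regularEval_algebraMap (q : SwapAlgebra) :
    regularEval ξ ξ' (algebraMap _ _ q) = pairingEval ξ ξ' q :=
  IsLocalization.lift_eq _ _

theorem regularInclusion_injective : Function.Injective (regularInclusion ξ ξ') := by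
  rw [injective_iff_map_eq_zero]
  intro f hf
  obtain ⟨⟨a, s⟩, h⟩ := IsLocalization.surj (pairingUnits ξ ξ') f
  have h1 := congrArg (regularInclusion ξ ξ') h
  rw [map_mul, hf, zero_mul, regularInclusion_algebraMap] at h1
  have ha : a = 0 := IsFractionRing.injective SwapAlgebra SwapFraction (by rw [← h1, map_zero])
  subst ha
  rw [map_zero] at h
  exact (IsLocalization.map_units (RegularFraction ξ ξ') s).mul_left_eq_zero.1 h

variable {ξ ξ'}

theorem pairingEval_pair (hc : ∀ a, (ξ' a).rep (ξ a).rep = 0) (X x : Boundary) :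
    pairingEval ξ ξ' (pair X x) = limitPairing ξ ξ' X x := by
  unfold pair
  split_ifs with h
  · exact MvPolynomial.aeval_X _ _
  · rw [not_not.1 h, map_zero, limitPairing, hc]

theorem X_mem_pairingUnits (ht : ∀ a b, a ≠ b → (ξ' a).rep (ξ b).rep ≠ 0) (g : Geodesic) :
    (MvPolynomial.X g : SwapAlgebra) ∈ pairingUnits ξ ξ' := by
  change pairingEval ξ ξ' (MvPolynomial.X g) ∈ nonZeroDivisors ℝ
  rw [mem_nonZeroDivisors_iff_ne_zero, pairingEval, MvPolynomial.aeval_X]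
  exact ht _ _ g.ne

theorem exists_regular_inverse (ht : ∀ a b, a ≠ b → (ξ' a).rep (ξ b).rep ≠ 0) (g : Geodesic) :
    ∃ f : RegularFraction ξ ξ', regularInclusion ξ ξ' f = (fpair g.tgt g.src)⁻¹ ∧
      regularEval ξ ξ' f = (limitPairing ξ ξ' g.tgt g.src)⁻¹ := by
  obtain ⟨f, hf⟩ := (IsLocalization.map_units (RegularFraction ξ ξ')
    (⟨_, X_mem_pairingUnits ht g⟩ : pairingUnits ξ ξ')).exists_right_inv
  have hp : fpair g.tgt g.src = algebraMap SwapAlgebra SwapFraction (MvPolynomial.X g) := by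
    simp [fpair, pair, g.ne]
  refine ⟨f, ?_, ?_⟩
  · have h := congrArg (regularInclusion ξ ξ') hf
    rw [map_mul, map_one, regularInclusion_algebraMap, ← hp] at h
    exact eq_inv_of_mul_eq_one_right h
  · have h := congrArg (regularEval ξ ξ') hf
    rw [map_mul, map_one, regularEval_algebraMap, pairingEval, MvPolynomial.aeval_X] at h
    exact eq_inv_of_mul_eq_one_right h

/-- Both `ghostMap` and the correlation factor through polynomials over the regular fractions. The
map from there to the log extension is injective, so the lift of `A` already vanishes. -/
theorem correlation_eq_zero [FiniteDimensional ℝ V]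
    (hc : ∀ a, (ξ' a).rep (ξ a).rep = 0) (ht : ∀ a b, a ≠ b → (ξ' a).rep (ξ b).rep ≠ 0)
    {A : GhostAlgebra} (hA : ghostMap A = 0) : correlation ξ ξ' A = 0 := by
  choose inv hinv₁ hinv₂ using exists_regular_inverse (ξ := ξ) (ξ' := ξ') ht
  let lift : GhostAlgebra →ₐ[ℝ] MvPolynomial (Option Geodesic) (RegularFraction ξ ξ') :=
    MvPolynomial.aeval fun
      | .casimir => MvPolynomial.X none
      | .geodesic g => MvPolynomial.X (some g)
      | .polygon G => MvPolynomial.C (G.loop (fun X x => algebraMap _ _ (pair X x)) inv)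
  let eval : MvPolynomial (Option Geodesic) (RegularFraction ξ ξ') →ₐ[ℝ] ℝ :=
    MvPolynomial.aevalTower (regularEval ξ ξ') fun
      | none => 1 / (Module.finrank ℝ V : ℝ)
      -- The trace of the rank-one projector `p(g)`.
      | some _ => 1
  have h1 : (MvPolynomial.mapAlgHom (regularInclusion ξ ξ')).comp lift = ghostMap := by
    refine MvPolynomial.algHom_ext fun s => ?_
    rw [AlgHom.comp_apply, ghostMap_X, MvPolynomial.aeval_X]
    cases s with
    | casimir => exact MvPolynomial.map_X _ _
    | geodesic g => exact MvPolynomial.map_X _ _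
    | polygon G =>
      refine (MvPolynomial.map_C _ _).trans ?_
      rw [Configuration.map_loop, Configuration.map_loop]
      unfold genImage lpair linv fpair
      congr
      · funext X x
        exact congrArg _ (regularInclusion_algebraMap ξ ξ' _)
      · funext g
        exact congrArg _ (hinv₁ g)
  have h2 : eval.comp lift = correlation ξ ξ' := by
    refine MvPolynomial.algHom_ext fun s => ?_
    rw [AlgHom.comp_apply, MvPolynomial.aeval_X, correlation, MvPolynomial.aeval_X]
    cases s with
    | casimir => exact MvPolynomial.aevalTower_X _ _ _
    | geodesic g =>
      refine (MvPolynomial.aevalTower_X _ _ _).trans ?_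
      simp only [projector, map_smul, LinearMap.trace_smulRight]
      exact (inv_mul_cancel₀ (ht _ _ g.ne)).symm
    | polygon G =>
      refine (MvPolynomial.aevalTower_C _ _ _).trans ?_
      change (regularEval ξ ξ').toRingHom _ = _
      rw [Configuration.map_loop]
      obtain ⟨l, hl, rfl⟩ := G.exists_eq_config
      refine Eq.trans ?_ (listTrace_eq_loop ξ ξ' l hl).symm
      rw [Configuration.loop_config]
      congr
      · funext X x
        exact (regularEval_algebraMap ξ ξ' _).trans (pairingEval_pair hc X x)
      · funext g
        exact hinv₂ g
  have h3 : lift A = 0 := by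
    apply MvPolynomial.map_injective _ (regularInclusion_injective ξ ξ')
    rw [map_zero, ← hA, ← h1]
    rfl
  rw [← h2, AlgHom.comp_apply, h3, map_zero]

end Correlation

/-! ### The quotient Poisson algebra -/

/-- The homomorphism from the ghost algebra to the extended swapping algebra. -/
def ghostHom : GhostAlgebra →ₐ[ℝ] extendedSwapping :=
  ghostMap.codRestrict extendedSwapping fun A => range_ghostMap ▸ ⟨A, rfl⟩

theorem ghostHom_surjective : Function.Surjective ghostHom := by
  rintro ⟨b, hb⟩
  rw [← range_ghostMap] at hb
  obtain ⟨A, rfl⟩ := hb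
  exact ⟨A, rfl⟩

theorem ghostHom_eq_zero_iff (A : GhostAlgebra) : ghostHom A = 0 ↔ ghostMap A = 0 :=
  Subtype.ext_iff

theorem quotient_mk_eq_iff (A B : GhostAlgebra) :
    Ideal.Quotient.mk (RingHom.ker ghostHom) A = Ideal.Quotient.mk (RingHom.ker ghostHom) B ↔
      ghostMap A = ghostMap B := by
  rw [Ideal.Quotient.eq, RingHom.mem_ker, ghostHom_eq_zero_iff, map_sub, sub_eq_zero]

/-- The quotient of the ghost algebra by the kernel. -/
abbrev GhostQuotient : Type := GhostAlgebra ⧸ RingHom.ker ghostHom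

/-- The bracket induced on the quotient, computed on representatives. -/
def quotientBracketFun (a b : GhostQuotient) : GhostQuotient :=
  Ideal.Quotient.mk _ (ghostBracket (Quotient.out a) (Quotient.out b))

/-- Independence of representatives: `ghostMap` of a bracket depends only on `ghostMap` of its
arguments. -/
theorem quotientBracketFun_mk (A B : GhostAlgebra) :
    quotientBracketFun (Ideal.Quotient.mk _ A) (Ideal.Quotient.mk _ B) =
      Ideal.Quotient.mk _ (ghostBracket A B) := by
  have h : ∀ C : GhostAlgebra, ghostMap (Quotient.out (Ideal.Quotient.mk
      (RingHom.ker ghostHom) C)) = ghostMap C := fun C =>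
    (quotient_mk_eq_iff _ _).1 (Ideal.Quotient.mk_out _)
  rw [quotientBracketFun, quotient_mk_eq_iff, ← extBracket_ghostMap, ← extBracket_ghostMap, h, h]

theorem extBracket_add_left (a b c : LogExtension) :
    extBracket (a + b) c = extBracket a c + extBracket b c :=
  (rightBracket c).map_add a b

theorem extBracket_smul_left (r : ℝ) (a b : LogExtension) :
    extBracket (r • a) b = r • extBracket a b :=
  (rightBracket b).map_smul r a

theorem quotient_mk_smul (r : ℝ) (A : GhostAlgebra) :
    r • Ideal.Quotient.mk (RingHom.ker ghostHom) A = Ideal.Quotient.mk _ (r • A) := rfl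

/-- The bracket induced on the quotient by the kernel. -/
def quotientBracket : GhostQuotient →ₗ[ℝ] GhostQuotient →ₗ[ℝ] GhostQuotient :=
  LinearMap.mk₂ ℝ quotientBracketFun
    (by
      intro a b c
      obtain ⟨A, rfl⟩ := Ideal.Quotient.mk_surjective a
      obtain ⟨B, rfl⟩ := Ideal.Quotient.mk_surjective b
      obtain ⟨C, rfl⟩ := Ideal.Quotient.mk_surjective c
      rw [← map_add, quotientBracketFun_mk, quotientBracketFun_mk, quotientBracketFun_mk,
        ← map_add, quotient_mk_eq_iff]
      simp only [map_add, ← extBracket_ghostMap, extBracket_add_left])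
    (by
      intro r a b
      obtain ⟨A, rfl⟩ := Ideal.Quotient.mk_surjective a
      obtain ⟨B, rfl⟩ := Ideal.Quotient.mk_surjective b
      rw [quotient_mk_smul, quotientBracketFun_mk, quotientBracketFun_mk, quotient_mk_smul,
        quotient_mk_eq_iff]
      simp only [map_smul, ← extBracket_ghostMap, extBracket_smul_left])
    (by
      intro a b c
      obtain ⟨A, rfl⟩ := Ideal.Quotient.mk_surjective a
      obtain ⟨B, rfl⟩ := Ideal.Quotient.mk_surjective b
      obtain ⟨C, rfl⟩ := Ideal.Quotient.mk_surjective c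
      rw [← map_add, quotientBracketFun_mk, quotientBracketFun_mk, quotientBracketFun_mk,
        ← map_add, quotient_mk_eq_iff]
      simp only [map_add, ← extBracket_ghostMap, extBracket_add_right])
    (by
      intro r a b
      obtain ⟨A, rfl⟩ := Ideal.Quotient.mk_surjective a
      obtain ⟨B, rfl⟩ := Ideal.Quotient.mk_surjective b
      rw [quotient_mk_smul, quotientBracketFun_mk, quotientBracketFun_mk, quotient_mk_smul,
        quotient_mk_eq_iff]
      simp only [map_smul, ← extBracket_ghostMap, extBracket_smul_right])

theorem quotientBracket_mk (A B : GhostAlgebra) :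
    quotientBracket (Ideal.Quotient.mk _ A) (Ideal.Quotient.mk _ B) =
      Ideal.Quotient.mk _ (ghostBracket A B) :=
  quotientBracketFun_mk A B

theorem isPoissonBracket_quotientBracket : IsPoissonBracket quotientBracket where
  skew a b := by
    obtain ⟨A, rfl⟩ := Ideal.Quotient.mk_surjective a
    obtain ⟨B, rfl⟩ := Ideal.Quotient.mk_surjective b
    rw [quotientBracket_mk, quotientBracket_mk, ← map_neg, quotient_mk_eq_iff, map_neg,
      ← extBracket_ghostMap, ← extBracket_ghostMap, extBracket_swap]
  leibniz a b c := by
    obtain ⟨A, rfl⟩ := Ideal.Quotient.mk_surjective a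
    obtain ⟨B, rfl⟩ := Ideal.Quotient.mk_surjective b
    obtain ⟨C, rfl⟩ := Ideal.Quotient.mk_surjective c
    rw [← map_mul, quotientBracket_mk, quotientBracket_mk, quotientBracket_mk, ← map_mul,
      ← map_mul, ← map_add, quotient_mk_eq_iff, map_add, map_mul, map_mul,
      ← extBracket_ghostMap, ← extBracket_ghostMap, ← extBracket_ghostMap, map_mul,
      extBracket_mul_right, add_comm, mul_comm (ghostMap C)]
  jacobi a b c := by
    obtain ⟨A, rfl⟩ := Ideal.Quotient.mk_surjective a
    obtain ⟨B, rfl⟩ := Ideal.Quotient.mk_surjective b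
    obtain ⟨C, rfl⟩ := Ideal.Quotient.mk_surjective c
    simp only [quotientBracket_mk]
    rw [← map_add, ← map_add, ← map_zero (Ideal.Quotient.mk _), quotient_mk_eq_iff, map_zero]
    simp only [map_add, ← extBracket_ghostMap]
    exact jacobiator_eq_zero _ _ _

end

end GhostSwap
-- The main theorem
theorem mainTheorem7 :
    ∃ π : GhostAlgebra →ₐ[ℝ] extendedSwapping,
      (π casimir : LogExtension) = central ∧
      (∀ g : Geodesic, (π (geod g) : LogExtension) = logGeod g) ∧
      (∀ (l : List Geodesic) (h : l ≠ []),
        (π (poly l h) : LogExtension) = lmulti l.get (finRotate l.length)) ∧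
      Function.Surjective π ∧
      (∀ a ∈ extendedSwapping, ∀ b ∈ extendedSwapping, extBracket a b ∈ extendedSwapping) ∧
      (∀ A B : GhostAlgebra,
        extBracket (π A) (π B) = (π (ghostBracket A B) : LogExtension)) ∧
      (∀ A : GhostAlgebra, extReverse (π A) = (π (ghostReverse A) : LogExtension)) ∧
      (∀ A : GhostAlgebra, π A = 0 →
        ∀ (Γ : Subgroup PSL(2, ℝ)), IsClosedSurfaceGroup Γ →
        ∀ (V : Type*) [NormedAddCommGroup V] [NormedSpace ℝ V] [FiniteDimensional ℝ V]
          (ρ : Representation ℝ Γ V) (ξ : Boundary → ℙ ℝ V) (ξ' : Boundary → ℙ ℝ (V →L[ℝ] ℝ)),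
          IsProjectiveAnosov Γ ρ ξ ξ' → correlation ξ ξ' A = 0) ∧
      ∃ br : (GhostAlgebra ⧸ RingHom.ker π) →ₗ[ℝ] (GhostAlgebra ⧸ RingHom.ker π) →ₗ[ℝ]
          (GhostAlgebra ⧸ RingHom.ker π),
        (∀ A B : GhostAlgebra,
          br (Ideal.Quotient.mk (RingHom.ker π) A) (Ideal.Quotient.mk (RingHom.ker π) B) =
            Ideal.Quotient.mk (RingHom.ker π) (ghostBracket A B)) ∧
        IsPoissonBracket br := by
  refine ⟨ghostHom, ghostMap_X _, fun g => ghostMap_X _, fun l h => ?_, ghostHom_surjective, ?_,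
    extBracket_ghostMap, extReverse_ghostMap, ?_, quotientBracket, quotientBracket_mk,
    isPoissonBracket_quotientBracket⟩
  · exact (ghostMap_poly l h).trans (loop_eq_lmulti l h)
  · intro a ha b hb
    rw [← range_ghostMap] at ha hb ⊢
    obtain ⟨A, rfl⟩ := ha
    obtain ⟨B, rfl⟩ := hb
    exact ⟨ghostBracket A B, (extBracket_ghostMap A B).symm⟩
  · intro A hA Γ _ V _ _ _ ρ ξ ξ' h
    exact correlation_eq_zero h.compatible h.transverse ((ghostHom_eq_zero_iff A).1 hA)
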